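/- Let $d\ge 1$, let $\nu\in\mathbb{R}^d$ and let $\Sigma$ be a symmetric positive definite real $d\times d$ matrix. Let $X_1,X_2,\dots$ be i.i.d. random vectors with the Gaussian law $N(\nu,\Sigma)$ on $\mathbb{R}^d$, and let $f$ be the density of this law. For $N\ge 2$ let $\rho_i:=\min\{\|X_i-X_j\| : 1\le j\le N,\ j\ne i\}$ (Euclidean norm), $i=1,\dots,N$, let $\overline{\rho}_N:=(\rho_1\cdots\rho_N)^{1/N}$, and let $$H_N:=d\log\overline{\rho}_N+\log V_d+\gamma+\log(N-1)$$ be the Kozachenko–Leonenko estimate, where $V_d=\pi^{d/2}/\Gamma(\frac d2+1)$ is the volume of the unit ball of $\mathbb{R}^d$ and $\gamma$ is the Euler–Mascheroni constant. Put $H:=\frac12\log\det(2\pi e\Sigma)$. Then $f\log f$ is integrable and $H=-\int_{\mathbb{R}^d} f(x)\log f(x)\,dx$ is the Shannon differential entropy of $f$; moreover $\mathsf{E}H_N^2<\infty$ for every $N\ge2$, and the estimates $H_N$ are asymptotically unbiased and $L^2$-consistent: $$\lim_{N\to\infty}\mathsf{E}H_N=H,\qquad \lim_{N\to\infty}\mathsf{E}(H_N-H)^2=0.$$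 -/

import Mathlib

open MeasureTheory ProbabilityTheory Filter Topology

noncomputable section

/-- The distance from the `i`-th point of a sample `x` to its nearest neighbour among
the other points: `min {‖x i - x j‖ : j ≠ i}` (a minimum over a nonempty finite set once the
sample has at least two points). -/
def nearestNeighborDist {d N : ℕ} (x : Fin N → EuclideanSpace ℝ (Fin d)) (i : Fin N) : ℝ :=
  ⨅ j : {j : Fin N // j ≠ i}, dist (x i) (x j)

/-- The geometric mean of the nearest neighbour distances of a sample. -/
def meanNearestNeighborDist {d N : ℕ} (x : Fin N → EuclideanSpace ℝ (Fin d)) : ℝ :=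
  (∏ i : Fin N, nearestNeighborDist x i) ^ ((1 : ℝ) / N)

/-- The volume `π ^ (d / 2) / Γ (d / 2 + 1)` of the unit ball of the Euclidean space `ℝ ^ d`. -/
def unitBallVolume (d : ℕ) : ℝ :=
  Real.pi ^ ((d : ℝ) / 2) / Real.Gamma ((d : ℝ) / 2 + 1)

/-- The Kozachenko-Leonenko entropy estimate computed from a sample `x` of size `N`. -/
def kozachenkoLeonenko {d N : ℕ} (x : Fin N → EuclideanSpace ℝ (Fin d)) : ℝ :=
  d * Real.log (meanNearestNeighborDist x) + Real.log (unitBallVolume d)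
    + Real.eulerMascheroniConstant + Real.log ((N : ℝ) - 1)

/-- The density of a law on `ℝ ^ d` with respect to Lebesgue measure (the law is required
separately to be absolutely continuous). -/
def lebesgueDensity {d : ℕ} (μ : Measure (EuclideanSpace ℝ (Fin d)))
    (x : EuclideanSpace ℝ (Fin d)) : ℝ :=
  (μ.rnDeriv volume x).toReal

/-- The Shannon differential entropy `-∫ f log f` of a density `f` on `ℝ ^ d`. -/
def shannonEntropy {d : ℕ} (f : EuclideanSpace ℝ (Fin d) → ℝ) : ℝ :=
  -∫ x, f x * Real.log (f x)

end

/-! Let `W i` be the probability, under the common law `μ` of the `X i`, of the ball around `X i`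
that reaches to its nearest neighbour. Given `X i`, it is the minimum of `N - 1` independent uniform
variables, so that `-log (W i)` has mean `1 + 1/2 + ⋯ + 1/(N - 1) = log (N - 1) + γ + o(1)` and
variance bounded in `N`. The ball shrinks to `X i`, so `log (W i)` minus the logarithm of its volume
tends to `log (f (X i))` almost surely, and in `L²` because `|log f|` grows at most quadratically
while `μ` has a fourth moment. Hence the estimate is the average of the terms `-log (f (X i))` plus
errors with vanishing mean and bounded second moment. For two sample points, truncating the radii at
half their distance makes the two balls disjoint, and the counts of further points in disjoint balls
are negatively dependent, so the covariance of the two errors is asymptotically nonpositive.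
Therefore the average of the errors tends to zero in `L²`, and the law of large numbers applies to
the average of the `-log (f (X i))`. -/

section Gaussian

open scoped RealInnerProductSpace MatrixOrder

section Standard

variable {E : Type*} [NormedAddCommGroup E] [InnerProductSpace ℝ E]

variable (E) in
/-- The density of the standard Gaussian law of a Euclidean space `E` with respect to Lebesgue
measure. -/
noncomputable def stdGaussianDensity (x : E) : ℝ :=
  (2 * Real.pi) ^ (-((Module.finrank ℝ E : ℝ) / 2)) * Real.exp (-‖x‖ ^ 2 / 2)

lemma stdGaussianDensity_pos (x : E) : 0 < stdGaussianDensity E x := by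
  unfold stdGaussianDensity
  positivity

@[fun_prop]
lemma continuous_stdGaussianDensity : Continuous (stdGaussianDensity E) := by
  unfold stdGaussianDensity
  fun_prop

lemma ofReal_stdGaussianDensity_mul_cexp (x t : E) :
    (stdGaussianDensity E x : ℂ) * Complex.exp (⟪x, t⟫ * Complex.I) =
      ((2 * Real.pi) ^ (-((Module.finrank ℝ E : ℝ) / 2)) : ℝ) *
        Complex.exp (-(1 / 2) * ‖x‖ ^ 2 + Complex.I * ⟪t, x⟫) := by
  rw [stdGaussianDensity, Complex.ofReal_mul, mul_assoc, Complex.ofReal_exp, ← Complex.exp_add,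
    real_inner_comm]
  congr 2
  push_cast
  ring

variable [FiniteDimensional ℝ E] [MeasurableSpace E] [BorelSpace E]

lemma integrable_stdGaussianDensity : Integrable (stdGaussianDensity E) := by
  have h := (GaussianFourier.integrable_cexp_neg_mul_sq_norm_add (V := E) (b := 1 / 2)
    (by norm_num) Complex.I 0).const_mul
    (((2 * Real.pi) ^ (-((Module.finrank ℝ E : ℝ) / 2)) : ℝ) : ℂ)
  simp_rw [← ofReal_stdGaussianDensity_mul_cexp, inner_zero_right] at h
  simpa using h.re

lemma integral_stdGaussianDensity_mul_cexp (t : E) :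
    ∫ x, (stdGaussianDensity E x : ℂ) * Complex.exp (⟪x, t⟫ * Complex.I) =
      Complex.exp (-‖t‖ ^ 2 / 2) := by
  have hconst : (((2 * Real.pi) ^ (-((Module.finrank ℝ E : ℝ) / 2)) : ℝ) : ℂ) *
      (Real.pi / (1 / 2) : ℂ) ^ (Module.finrank ℝ E / 2 : ℂ) = 1 := by
    have hbase : (Real.pi / (1 / 2) : ℂ) = ((2 * Real.pi : ℝ) : ℂ) := by
      push_cast
      ring
    have hexp : (Module.finrank ℝ E / 2 : ℂ) = ((Module.finrank ℝ E / 2 : ℝ) : ℂ) := by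
      push_cast
      ring
    rw [hbase, hexp, ← Complex.ofReal_cpow (by positivity), ← Complex.ofReal_mul,
      ← Real.rpow_add (by positivity), neg_add_cancel, Real.rpow_zero, Complex.ofReal_one]
  simp_rw [ofReal_stdGaussianDensity_mul_cexp]
  rw [integral_const_mul,
    GaussianFourier.integral_cexp_neg_mul_sq_norm_add (by norm_num) Complex.I t, ← mul_assoc,
    hconst, one_mul, Complex.I_sq]
  congr 1
  ring

lemma stdGaussian_eq_withDensity :
    stdGaussian E = volume.withDensity fun x => ENNReal.ofReal (stdGaussianDensity E x) := by
  have : IsFiniteMeasure (volume.withDensity fun x => ENNReal.ofReal (stdGaussianDensity E x)) :=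
    isFiniteMeasure_withDensity_ofReal integrable_stdGaussianDensity.2
  refine Measure.ext_of_charFun (funext fun t => ?_)
  rw [charFun_stdGaussian, charFun_apply, integral_withDensity_eq_integral_toReal_smul
    (by fun_prop) (Eventually.of_forall fun x => ENNReal.ofReal_lt_top)]
  simp_rw [ENNReal.toReal_ofReal (stdGaussianDensity_pos _).le, Complex.real_smul]
  exact (integral_stdGaussianDensity_mul_cexp t).symm

lemma integral_norm_sq_stdGaussian :
    ∫ x, ‖x‖ ^ 2 ∂(stdGaussian E) = Module.finrank ℝ E := by
  let b := stdOrthonormalBasis ℝ E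
  have hcoord (i) : ∫ x, ⟪b i, x⟫ ^ 2 ∂(stdGaussian E) = 1 := by
    have hvar := variance_dual_stdGaussian (innerSL ℝ (b i))
    rw [variance_of_integral_eq_zero (by fun_prop) (integral_strongDual_stdGaussian _)] at hvar
    simpa using hvar
  have hint (i) : Integrable (fun x => ⟪b i, x⟫ ^ 2) (stdGaussian E) :=
    (IsGaussian.memLp_dual (stdGaussian E) (innerSL ℝ (b i)) 2 (by simp)).integrable_sq
  simp_rw [← b.sum_sq_inner_right]
  rw [integral_finsetSum _ fun i _ => hint i]
  simp [hcoord]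

lemma map_withDensity_add_continuousLinearEquiv (L : E ≃L[ℝ] E) (v : E) (g : E → ENNReal) :
    (volume.withDensity g).map (fun x => v + L x) = volume.withDensity fun x =>
      ENNReal.ofReal |LinearMap.det (L : E →ₗ[ℝ] E)|⁻¹ * g (L.symm (x - v)) := by
  have hderiv (x : E) : HasFDerivAt (fun x => v + L x) (L : E →L[ℝ] E) x :=
    L.hasFDerivAt.const_add v
  have hinj : Function.Injective fun x => v + L x := (add_right_injective v).comp L.injective
  have hsurj : Function.Surjective fun x => v + L x := (add_left_surjective v).comp L.surjective
  have hdet : (L : E →L[ℝ] E).det ≠ 0 := L.toLinearEquiv.isUnit_det'.ne_zero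
  ext s hs
  have hpre : MeasurableSet ((fun x => v + L x) ⁻¹' s) := by measurability
  rw [Measure.map_apply (by fun_prop) hs, withDensity_apply _ hpre, withDensity_apply _ hs]
  conv_rhs => rw [← Set.image_preimage_eq s hsurj, lintegral_image_eq_lintegral_abs_det_fderiv_mul
    volume hpre (fun x _ => (hderiv x).hasFDerivWithinAt) hinj.injOn]
  refine lintegral_congr fun x => ?_
  change _ = ENNReal.ofReal |(L : E →L[ℝ] E).det| *
    (ENNReal.ofReal |(L : E →L[ℝ] E).det|⁻¹ * _)
  rw [← mul_assoc, ← ENNReal.ofReal_mul (abs_nonneg _), mul_inv_cancel₀ (abs_ne_zero.2 hdet)]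
  simp

end Standard

section Matrix

variable {ι : Type*} [Fintype ι] [DecidableEq ι]

lemma toEuclideanCLM_inv_apply_apply {A : Matrix ι ι ℝ} (hA : IsUnit A.det)
    (x : EuclideanSpace ℝ ι) :
    Matrix.toEuclideanCLM (𝕜 := ℝ) A⁻¹ (Matrix.toEuclideanCLM (𝕜 := ℝ) A x) = x := by
  rw [← ContinuousLinearMap.comp_apply, ← ContinuousLinearMap.mul_def, ← map_mul,
    Matrix.nonsing_inv_mul _ hA, map_one, one_apply_eq_self]

lemma toEuclideanCLM_apply_inv_apply {A : Matrix ι ι ℝ} (hA : IsUnit A.det)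
    (x : EuclideanSpace ℝ ι) :
    Matrix.toEuclideanCLM (𝕜 := ℝ) A (Matrix.toEuclideanCLM (𝕜 := ℝ) A⁻¹ x) = x := by
  rw [← ContinuousLinearMap.comp_apply, ← ContinuousLinearMap.mul_def, ← map_mul,
    Matrix.mul_nonsing_inv _ hA, map_one, one_apply_eq_self]

lemma det_toEuclideanCLM (A : Matrix ι ι ℝ) :
    LinearMap.det (Matrix.toEuclideanCLM (𝕜 := ℝ) A : EuclideanSpace ℝ ι →ₗ[ℝ] _) = A.det := by
  rw [Matrix.coe_toEuclideanCLM_eq_toEuclideanLin, Matrix.toEuclideanLin_eq_toLin_orthonormal,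
    LinearMap.det_toLin]

variable {S : Matrix ι ι ℝ}

lemma abs_det_cfc_sqrt (hS : S.PosSemidef) : |(CFC.sqrt S).det| = Real.sqrt S.det := by
  rw [← Real.sqrt_sq_eq_abs, pow_two, ← Matrix.det_mul, CFC.sqrt_mul_sqrt_self S hS.nonneg]

lemma isUnit_det_cfc_sqrt (hS : S.PosDef) : IsUnit (CFC.sqrt S).det := by
  rw [isUnit_iff_ne_zero, ← abs_pos, abs_det_cfc_sqrt hS.posSemidef]
  exact Real.sqrt_pos.2 hS.det_pos

end Matrix

section Multivariate

variable {ι : Type*} [Fintype ι] [DecidableEq ι] {ν : EuclideanSpace ℝ ι} {S : Matrix ι ι ℝ}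

/-- The Lebesgue density of the Gaussian law with mean `ν` and nondegenerate covariance `S`; the
Mahalanobis distance of `x` to `ν` is encoded as the norm of `S ^ (-1 / 2) (x - ν)`. -/
noncomputable def gaussianDensity (ν : EuclideanSpace ℝ ι) (S : Matrix ι ι ℝ)
    (x : EuclideanSpace ℝ ι) : ℝ :=
  (Real.sqrt S.det)⁻¹ * stdGaussianDensity (EuclideanSpace ℝ ι)
    (Matrix.toEuclideanCLM (𝕜 := ℝ) (CFC.sqrt S)⁻¹ (x - ν))

lemma gaussianDensity_pos (hS : S.PosDef) (x : EuclideanSpace ℝ ι) : 0 < gaussianDensity ν S x :=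
  mul_pos (inv_pos.2 (Real.sqrt_pos.2 hS.det_pos)) (stdGaussianDensity_pos _)

lemma continuous_gaussianDensity : Continuous (gaussianDensity ν S) := by
  unfold gaussianDensity
  fun_prop

lemma multivariateGaussian_eq_withDensity (hS : S.PosDef) :
    multivariateGaussian ν S =
      volume.withDensity fun x => ENNReal.ofReal (gaussianDensity ν S x) := by
  have hunit := isUnit_det_cfc_sqrt hS
  let L : EuclideanSpace ℝ ι ≃L[ℝ] EuclideanSpace ℝ ι := .equivOfInverse
    (Matrix.toEuclideanCLM (𝕜 := ℝ) (CFC.sqrt S)) (Matrix.toEuclideanCLM (𝕜 := ℝ) (CFC.sqrt S)⁻¹)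
    (toEuclideanCLM_inv_apply_apply hunit) (toEuclideanCLM_apply_inv_apply hunit)
  have hdet : |LinearMap.det (L : EuclideanSpace ℝ ι →ₗ[ℝ] _)| = Real.sqrt S.det :=
    (congrArg abs (det_toEuclideanCLM (CFC.sqrt S))).trans (abs_det_cfc_sqrt hS.posSemidef)
  calc multivariateGaussian ν S = (stdGaussian (EuclideanSpace ℝ ι)).map (fun x => ν + L x) := rfl
    _ = volume.withDensity fun x => ENNReal.ofReal (Real.sqrt S.det)⁻¹ *
        ENNReal.ofReal (stdGaussianDensity (EuclideanSpace ℝ ι) (L.symm (x - ν))) := by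
      rw [stdGaussian_eq_withDensity, map_withDensity_add_continuousLinearEquiv, hdet]
    _ = volume.withDensity fun x => ENNReal.ofReal (gaussianDensity ν S x) := by
      simp_rw [← ENNReal.ofReal_mul (inv_nonneg.2 (Real.sqrt_nonneg S.det))]
      rfl

lemma log_gaussianDensity (hS : S.PosDef) (x : EuclideanSpace ℝ ι) :
    Real.log (gaussianDensity ν S x) =
      -(1 / 2 * Real.log S.det + Fintype.card ι / 2 * Real.log (2 * Real.pi)) -
        ‖Matrix.toEuclideanCLM (𝕜 := ℝ) (CFC.sqrt S)⁻¹ (x - ν)‖ ^ 2 / 2 := by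
  have := hS.det_pos
  rw [gaussianDensity, stdGaussianDensity, Real.log_mul (by positivity) (by positivity),
    Real.log_mul (by positivity) (by positivity), Real.log_exp, Real.log_rpow (by positivity),
    Real.log_inv, Real.log_sqrt this.le, finrank_euclideanSpace]
  ring

lemma exists_abs_log_gaussianDensity_le (hS : S.PosDef) :
    ∃ K : ℝ, ∀ x, |Real.log (gaussianDensity ν S x)| ≤ K * (1 + ‖x‖ ^ 2) := by
  set B := Matrix.toEuclideanCLM (𝕜 := ℝ) (CFC.sqrt S)⁻¹
  set c := 1 / 2 * Real.log S.det + Fintype.card ι / 2 * Real.log (2 * Real.pi)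
  refine ⟨|c| + ‖B‖ ^ 2 * (1 + ‖ν‖ ^ 2), fun x => ?_⟩
  have hquad : ‖B (x - ν)‖ ^ 2 / 2 ≤ ‖B‖ ^ 2 * (‖x‖ ^ 2 + ‖ν‖ ^ 2) := by
    have hnorm : ‖B (x - ν)‖ ≤ ‖B‖ * (‖x‖ + ‖ν‖) :=
      (B.le_opNorm _).trans (by gcongr; exact norm_sub_le _ _)
    calc ‖B (x - ν)‖ ^ 2 / 2 ≤ (‖B‖ * (‖x‖ + ‖ν‖)) ^ 2 / 2 := by gcongr
      _ ≤ ‖B‖ ^ 2 * (2 * (‖x‖ ^ 2 + ‖ν‖ ^ 2)) / 2 := by rw [mul_pow]; gcongr; exact add_sq_le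
      _ = ‖B‖ ^ 2 * (‖x‖ ^ 2 + ‖ν‖ ^ 2) := by ring
  calc |Real.log (gaussianDensity ν S x)| = |(-c - ‖B (x - ν)‖ ^ 2 / 2)| := by
        rw [log_gaussianDensity hS]
    _ ≤ |c| + ‖B (x - ν)‖ ^ 2 / 2 := by
        refine (abs_sub _ _).trans_eq ?_
        rw [abs_neg, abs_of_nonneg (by positivity : (0 : ℝ) ≤ ‖B (x - ν)‖ ^ 2 / 2)]
    _ ≤ |c| * (1 + ‖x‖ ^ 2) + ‖B‖ ^ 2 * (‖x‖ ^ 2 + ‖ν‖ ^ 2 + (1 + ‖ν‖ ^ 2 * ‖x‖ ^ 2)) := by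
        gcongr
        · exact le_mul_of_one_le_right (abs_nonneg c) (le_add_of_nonneg_right (sq_nonneg _))
        · exact hquad.trans (mul_le_mul_of_nonneg_left
            (le_add_of_nonneg_right (by positivity)) (sq_nonneg _))
    _ = (|c| + ‖B‖ ^ 2 * (1 + ‖ν‖ ^ 2)) * (1 + ‖x‖ ^ 2) := by ring

lemma integrable_norm_sq_mahalanobis :
    Integrable (fun x => ‖Matrix.toEuclideanCLM (𝕜 := ℝ) (CFC.sqrt S)⁻¹ (x - ν)‖ ^ 2)
      (multivariateGaussian ν S) := by
  have hsub : MemLp (fun x => x - ν) 2 (multivariateGaussian ν S) :=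
    IsGaussian.memLp_two_id.sub (memLp_const ν)
  exact ((Matrix.toEuclideanCLM (𝕜 := ℝ) (CFC.sqrt S)⁻¹).comp_memLp' hsub).integrable_norm_pow
    (by norm_num)

lemma integral_norm_sq_mahalanobis (hS : S.PosDef) :
    ∫ x, ‖Matrix.toEuclideanCLM (𝕜 := ℝ) (CFC.sqrt S)⁻¹ (x - ν)‖ ^ 2
      ∂(multivariateGaussian ν S) = Fintype.card ι := by
  rw [multivariateGaussian, integral_map (by fun_prop) (by fun_prop)]
  simp only [add_sub_cancel_left, toEuclideanCLM_inv_apply_apply (isUnit_det_cfc_sqrt hS)]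
  rw [integral_norm_sq_stdGaussian, finrank_euclideanSpace]

lemma integral_log_gaussianDensity (hS : S.PosDef) :
    ∫ x, Real.log (gaussianDensity ν S x) ∂(multivariateGaussian ν S) =
      -(1 / 2 * Real.log (((2 * Real.pi * Real.exp 1) • S).det)) := by
  simp_rw [log_gaussianDensity hS]
  rw [integral_sub (integrable_const _) (integrable_norm_sq_mahalanobis.div_const 2), integral_div,
    integral_norm_sq_mahalanobis hS, integral_const, probReal_univ, one_smul, Matrix.det_smul,
    Real.log_mul (by positivity) hS.det_pos.ne', Real.log_pow,
    Real.log_mul (x := 2 * Real.pi) (by positivity) (by positivity), Real.log_exp]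
  ring

end Multivariate

end Gaussian

section MinUniform

/-- The law of the minimum of `n` independent variables uniform on the unit interval, given by
its density (for `n = 0` this is the zero measure). -/
noncomputable def minUniformLaw (n : ℕ) : Measure ℝ :=
  (volume.restrict (Set.Ioc 0 1)).withDensity fun u => ENNReal.ofReal (n * (1 - u) ^ (n - 1))

variable {n : ℕ}

lemma hasDerivAt_one_sub_pow (n : ℕ) (u : ℝ) :
    HasDerivAt (fun u : ℝ => (1 - u) ^ n) (-(n * (1 - u) ^ (n - 1))) u := by
  simpa using ((hasDerivAt_id u).const_sub 1).fun_pow n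

lemma minUniform_density_nonneg {u : ℝ} (hu : u ≤ 1) : 0 ≤ (n : ℝ) * (1 - u) ^ (n - 1) :=
  mul_nonneg n.cast_nonneg (pow_nonneg (sub_nonneg.2 hu) _)

lemma ae_minUniformLaw_mem_Ioc : ∀ᵐ u ∂(minUniformLaw n), u ∈ Set.Ioc (0 : ℝ) 1 :=
  (withDensity_absolutelyContinuous _ _).ae_le (ae_restrict_mem measurableSet_Ioc)

lemma minUniformLaw_Iic {a : ℝ} (h0 : 0 ≤ a) (h1 : a ≤ 1) :
    minUniformLaw n (Set.Iic a) = ENNReal.ofReal (1 - (1 - a) ^ n) := by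
  have hset : Set.Iic a ∩ Set.Ioc 0 1 = Set.Ioc 0 a := by grind
  have hint : ∫ u in (0 : ℝ)..a, n * (1 - u) ^ (n - 1) = 1 - (1 - a) ^ n := by
    rw [intervalIntegral.integral_eq_sub_of_hasDerivAt
      (fun u _ => (hasDerivAt_one_sub_pow n u).neg.congr_deriv (neg_neg _))
      (Continuous.intervalIntegrable (by fun_prop) _ _)]
    simp [add_comm, sub_eq_add_neg]
  rw [minUniformLaw, withDensity_apply _ measurableSet_Iic,
    Measure.restrict_restrict measurableSet_Iic, hset, ← hint,
    intervalIntegral.integral_of_le h0, ofReal_integral_eq_lintegral_ofReal]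
  · exact Continuous.integrableOn_Ioc (by fun_prop)
  · filter_upwards [ae_restrict_mem measurableSet_Ioc] with u hu
    exact minUniform_density_nonneg (hu.2.trans h1)

instance isFiniteMeasure_minUniformLaw : IsFiniteMeasure (minUniformLaw n) :=
  isFiniteMeasure_withDensity_ofReal
    (Continuous.integrableOn_Ioc (f := fun u : ℝ => n * (1 - u) ^ (n - 1)) (by fun_prop)).2

lemma hasLaw_minUniformLaw_of_measure_lt {Ω : Type*} [MeasurableSpace Ω] {Q : Measure Ω}
    [IsProbabilityMeasure Q] {W : Ω → ℝ} (hn : n ≠ 0) (hW : Measurable W) (hle : ∀ ω, W ω ≤ 1)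
    (htail : ∀ u ∈ Set.Ico (0 : ℝ) 1, Q {ω | u < W ω} = ENNReal.ofReal ((1 - u) ^ n)) :
    HasLaw W (minUniformLaw n) Q := by
  have : IsProbabilityMeasure (Q.map W) := Measure.isProbabilityMeasure_map hW.aemeasurable
  have hcdf (a : ℝ) (ha : a ∈ Set.Ico (0 : ℝ) 1) :
      Q.map W (Set.Iic a) = minUniformLaw n (Set.Iic a) := by
    have hcompl : W ⁻¹' Set.Iic a = {ω | a < W ω}ᶜ := by ext; simp
    rw [Measure.map_apply hW measurableSet_Iic, hcompl,
      prob_compl_eq_one_sub (measurableSet_lt measurable_const hW), htail a ha,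
      minUniformLaw_Iic ha.1 ha.2.le, ENNReal.ofReal_sub _ (pow_nonneg (sub_nonneg.2 ha.2.le) _),
      ENNReal.ofReal_one]
  refine ⟨hW.aemeasurable, Measure.ext_of_Iic _ _ fun a => ?_⟩
  rcases lt_or_ge a 0 with h0 | h0
  · have hzero : minUniformLaw n (Set.Iic 0) = 0 := by
      simpa using minUniformLaw_Iic (n := n) le_rfl zero_le_one
    have hsub : Set.Iic a ⊆ Set.Iic 0 := Set.Iic_subset_Iic.2 h0.le
    rw [measure_mono_null hsub hzero,
      measure_mono_null hsub ((hcdf 0 ⟨le_rfl, one_pos⟩).trans hzero)]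
  rcases lt_or_ge a 1 with h1 | h1
  · exact hcdf a ⟨h0, h1⟩
  · have hW_univ : W ⁻¹' Set.Iic a = Set.univ := Set.eq_univ_of_forall fun ω => (hle ω).trans h1
    have hae : (Set.Iic a : Set ℝ) =ᵐ[minUniformLaw n] (Set.Iic 1 : Set ℝ) := by
      filter_upwards [ae_minUniformLaw_mem_Ioc] with u hu
      exact propext ⟨fun _ => hu.2, fun _ => hu.2.trans h1⟩
    rw [Measure.map_apply hW measurableSet_Iic, hW_univ, measure_univ, measure_congr hae,
      minUniformLaw_Iic zero_le_one le_rfl]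
    simp [zero_pow hn]

lemma integral_minUniformLaw (φ : ℝ → ℝ) :
    ∫ u, φ u ∂(minUniformLaw n) = ∫ u in (0 : ℝ)..1, n * (1 - u) ^ (n - 1) * φ u := by
  rw [minUniformLaw, integral_withDensity_eq_integral_toReal_smul (by fun_prop)
    (Eventually.of_forall fun x => ENNReal.ofReal_lt_top),
    intervalIntegral.integral_of_le zero_le_one]
  refine setIntegral_congr_fun measurableSet_Ioc fun u hu => ?_
  simp only [smul_eq_mul]
  rw [ENNReal.toReal_ofReal (minUniform_density_nonneg hu.2)]

lemma integrable_minUniformLaw_iff (φ : ℝ → ℝ) :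
    Integrable φ (minUniformLaw n) ↔
      IntervalIntegrable (fun u => n * (1 - u) ^ (n - 1) * φ u) volume 0 1 := by
  rw [minUniformLaw, integrable_withDensity_iff_integrable_smul' (by fun_prop)
    (Eventually.of_forall fun x => ENNReal.ofReal_lt_top),
    intervalIntegrable_iff_integrableOn_Ioc_of_le zero_le_one, IntegrableOn]
  refine integrable_congr ?_
  filter_upwards [ae_restrict_mem measurableSet_Ioc] with u hu
  simp only [smul_eq_mul]
  rw [ENNReal.toReal_ofReal (minUniform_density_nonneg hu.2)]

lemma integral_id_minUniformLaw (hn : n ≠ 0) : ∫ u, u ∂(minUniformLaw n) = 1 / ((n : ℝ) + 1) := by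
  have hderiv (u : ℝ) : HasDerivAt (fun u : ℝ => -(u * (1 - u) ^ n + (1 - u) ^ (n + 1) / (n + 1)))
      (n * (1 - u) ^ (n - 1) * u) u := by
    refine (((hasDerivAt_id u).mul (hasDerivAt_one_sub_pow n u)).add
      ((hasDerivAt_one_sub_pow (n + 1) u).div_const ((n : ℝ) + 1))).neg.congr_deriv ?_
    push_cast
    simp only [id]
    field_simp
    ring
  rw [integral_minUniformLaw, intervalIntegral.integral_eq_sub_of_hasDerivAt
    (fun u _ => hderiv u) (Continuous.intervalIntegrable (by fun_prop) _ _)]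
  simp [zero_pow hn]

lemma intervalIntegral_log_minUniform_succ_sub (n : ℕ) :
    ∫ u in (0 : ℝ)..1, ((n + 1) * (1 - u) ^ n - n * (1 - u) ^ (n - 1)) * Real.log u =
      -((n : ℝ) + 1)⁻¹ := by
  have hderiv (u : ℝ) (hu : u ∈ Set.Ioo (0 : ℝ) 1) :
      HasDerivAt (fun u : ℝ => (1 - u) ^ n * (u * Real.log u) + (1 - u) ^ (n + 1) / (n + 1))
        (((n + 1) * (1 - u) ^ n - n * (1 - u) ^ (n - 1)) * Real.log u) u := by
    have hpow : (n : ℝ) * (1 - u) ^ (n - 1) * (1 - u) = n * (1 - u) ^ n := by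
      rcases n with _ | n
      · simp
      · rw [Nat.add_sub_cancel, mul_assoc, ← pow_succ]
    refine (((hasDerivAt_one_sub_pow n u).mul (Real.hasDerivAt_mul_log hu.1.ne')).add
      ((hasDerivAt_one_sub_pow (n + 1) u).div_const ((n : ℝ) + 1))).congr_deriv ?_
    have hquot : -(((n + 1 : ℕ) : ℝ) * (1 - u) ^ (n + 1 - 1)) / ((n : ℝ) + 1) = -(1 - u) ^ n := by
      push_cast
      field_simp
    rw [hquot]
    linear_combination Real.log u * hpow
  rw [intervalIntegral.integral_eq_sub_of_hasDerivAt_of_le zero_le_one _ hderiv]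
  · simp
  · exact intervalIntegral.intervalIntegrable_log'.continuousOn_mul (by fun_prop)
  · have := Real.continuous_mul_log
    fun_prop

lemma integral_log_minUniformLaw : ∫ u, Real.log u ∂(minUniformLaw n) = -(harmonic n : ℝ) := by
  have hint (m : ℕ) :
      IntervalIntegrable (fun u => m * (1 - u) ^ (m - 1) * Real.log u) volume 0 1 :=
    intervalIntegral.intervalIntegrable_log'.continuousOn_mul (by fun_prop)
  induction n with
  | zero => simp [minUniformLaw]
  | succ n ih =>
    have hdiff := intervalIntegral_log_minUniform_succ_sub n
    simp_rw [sub_mul] at hdiff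
    rw [intervalIntegral.integral_sub (by simpa using hint (n + 1)) (hint n),
      ← integral_minUniformLaw, ih] at hdiff
    rw [integral_minUniformLaw, harmonic_succ]
    push_cast
    linarith

lemma log_sq_le_of_le_one {t : ℝ} (ht : 0 < t) (h : t ≤ 1) :
    Real.log t ^ 2 ≤ 16 * t ^ (-(1 / 2) : ℝ) := by
  have hlog : (Real.log t * t ^ (1 / 4 : ℝ)) ^ 2 ≤ 16 := by
    have habs := (Real.abs_log_mul_self_rpow_lt t (1 / 4) ht h (by norm_num)).le
    rw [one_div_one_div] at habs
    exact (sq_le_sq.2 (habs.trans_eq (Nat.abs_ofNat 4).symm)).trans_eq (by norm_num)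
  have hsq : (t ^ (1 / 4 : ℝ)) ^ 2 = t ^ (1 / 2 : ℝ) := by
    rw [← Real.rpow_mul_natCast ht.le]
    norm_num
  rw [mul_pow, hsq] at hlog
  rwa [Real.rpow_neg ht.le, ← div_eq_mul_inv, le_div_iff₀ (by positivity)]

lemma log_sq_le_of_one_le {t : ℝ} (h : 1 ≤ t) : Real.log t ^ 2 ≤ 4 * t := by
  have ht : 0 ≤ t := zero_le_one.trans h
  calc Real.log t ^ 2 ≤ (t ^ (1 / 2 : ℝ) / (1 / 2)) ^ 2 :=
        pow_le_pow_left₀ (Real.log_nonneg h) (Real.log_le_rpow_div ht (by norm_num)) 2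
    _ = 4 * t := by
        rw [div_pow, ← Real.rpow_mul_natCast ht]
        norm_num
        ring

lemma memLp_log_minUniformLaw : MemLp Real.log 2 (minUniformLaw n) := by
  rw [memLp_two_iff_integrable_sq (by fun_prop)]
  have hdom : Integrable (fun u : ℝ => 16 * u ^ (-(1 / 2) : ℝ)) (minUniformLaw n) := by
    rw [integrable_minUniformLaw_iff]
    exact ((intervalIntegral.intervalIntegrable_rpow' (by norm_num)).const_mul 16).continuousOn_mul
      (by fun_prop)
  refine hdom.mono' (by fun_prop) ?_
  filter_upwards [ae_minUniformLaw_mem_Ioc] with u hu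
  rw [Real.norm_of_nonneg (sq_nonneg _)]
  exact log_sq_le_of_le_one hu.1 hu.2

lemma memLp_log_const_mul_minUniformLaw {c : ℝ} (hc : 0 < c) :
    MemLp (fun u => Real.log (c * u)) 2 (minUniformLaw n) := by
  refine ((memLp_const (Real.log c)).add memLp_log_minUniformLaw).ae_eq ?_
  filter_upwards [ae_minUniformLaw_mem_Ioc] with u hu
  exact (Real.log_mul hc.ne' hu.1.ne').symm

lemma inv_cast_add_one_mem_Icc (n : ℕ) : ((n : ℝ) + 1)⁻¹ ∈ Set.Icc (0 : ℝ) 1 :=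
  ⟨by positivity, inv_le_one_of_one_le₀ (by simp)⟩

lemma intervalIntegrable_log_sq_minUniform {a b : ℝ} (ha : a ∈ Set.Icc (0 : ℝ) 1)
    (hb : b ∈ Set.Icc (0 : ℝ) 1) :
    IntervalIntegrable (fun u => n * (1 - u) ^ (n - 1) * Real.log ((n + 1) * u) ^ 2)
      volume a b := by
  have hint := (memLp_log_const_mul_minUniformLaw (n := n) n.cast_add_one_pos).integrable_sq
  refine ((integrable_minUniformLaw_iff _).1 hint).mono_set ?_
  rw [Set.uIcc_of_le zero_le_one]
  exact Set.uIcc_subset_Icc ha hb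

lemma intervalIntegral_log_sq_minUniform_left_le (n : ℕ) :
    ∫ u in (0 : ℝ)..(n + 1 : ℝ)⁻¹, n * (1 - u) ^ (n - 1) * Real.log ((n + 1) * u) ^ 2 ≤ 32 := by
  have hN : (0 : ℝ) < n + 1 := n.cast_add_one_pos
  have hinv := inv_cast_add_one_mem_Icc n
  set C : ℝ := n * (16 * ((n : ℝ) + 1) ^ (-(1 / 2) : ℝ)) with hC
  have hpoint (u : ℝ) (hu : u ∈ Set.Ioo 0 ((n : ℝ) + 1)⁻¹) :
      n * (1 - u) ^ (n - 1) * Real.log ((n + 1) * u) ^ 2 ≤ C * u ^ (-(1 / 2) : ℝ) := by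
    have ht : ((n : ℝ) + 1) * u ≤ 1 :=
      (mul_le_mul_of_nonneg_left hu.2.le hN.le).trans_eq (mul_inv_cancel₀ hN.ne')
    have hlog := log_sq_le_of_le_one (mul_pos hN hu.1) ht
    have hpow : (1 - u) ^ (n - 1) ≤ 1 :=
      pow_le_one₀ (by linarith [hu.2, hinv.2]) (by linarith [hu.1])
    rw [Real.mul_rpow hN.le hu.1.le] at hlog
    calc n * (1 - u) ^ (n - 1) * Real.log ((n + 1) * u) ^ 2
        ≤ n * 1 * (16 * (((n : ℝ) + 1) ^ (-(1 / 2) : ℝ) * u ^ (-(1 / 2) : ℝ))) := by gcongr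
      _ = C * u ^ (-(1 / 2) : ℝ) := by ring
  calc ∫ u in (0 : ℝ)..(n + 1 : ℝ)⁻¹, n * (1 - u) ^ (n - 1) * Real.log ((n + 1) * u) ^ 2
      ≤ ∫ u in (0 : ℝ)..(n + 1 : ℝ)⁻¹, C * u ^ (-(1 / 2) : ℝ) :=
        intervalIntegral.integral_mono_on_of_le_Ioo hinv.1
          (intervalIntegrable_log_sq_minUniform ⟨le_rfl, zero_le_one⟩ hinv)
          ((intervalIntegral.intervalIntegrable_rpow' (by norm_num)).const_mul _) hpoint
    _ = 32 * (n * (((n : ℝ) + 1)⁻¹ ^ (1 / 2 : ℝ) * ((n : ℝ) + 1)⁻¹ ^ (1 / 2 : ℝ))) := by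
        rw [intervalIntegral.integral_const_mul, integral_rpow (Or.inl (by norm_num)), hC,
          Real.rpow_neg hN.le, ← Real.inv_rpow hN.le]
        norm_num
        ring
    _ = 32 * (n / (n + 1)) := by
        rw [← Real.rpow_add (by positivity), add_halves, Real.rpow_one, div_eq_mul_inv]
    _ ≤ 32 := mul_le_of_le_one_right (by norm_num) (div_le_one_of_le₀ (by linarith) hN.le)

lemma intervalIntegral_log_sq_minUniform_right_le (hn : n ≠ 0) :
    ∫ u in (n + 1 : ℝ)⁻¹..1, n * (1 - u) ^ (n - 1) * Real.log ((n + 1) * u) ^ 2 ≤ 4 := by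
  have hN : (0 : ℝ) < n + 1 := n.cast_add_one_pos
  have hinv := inv_cast_add_one_mem_Icc n
  have hint (b c : ℝ) : IntervalIntegrable (fun u : ℝ => n * (1 - u) ^ (n - 1) * u) volume b c :=
    Continuous.intervalIntegrable (by fun_prop) _ _
  have hpoint (u : ℝ) (hu : u ∈ Set.Icc ((n : ℝ) + 1)⁻¹ 1) :
      n * (1 - u) ^ (n - 1) * Real.log ((n + 1) * u) ^ 2 ≤
        4 * (n + 1) * (n * (1 - u) ^ (n - 1) * u) := by
    have ht : 1 ≤ ((n : ℝ) + 1) * u :=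
      (mul_inv_cancel₀ hN.ne').symm.trans_le (mul_le_mul_of_nonneg_left hu.1 hN.le)
    refine (mul_le_mul_of_nonneg_left (log_sq_le_of_one_le ht)
      (minUniform_density_nonneg hu.2)).trans_eq ?_
    ring
  have hmean : ∫ u in (n + 1 : ℝ)⁻¹..1, n * (1 - u) ^ (n - 1) * u ≤ 1 / (n + 1) := by
    rw [← integral_id_minUniformLaw hn, integral_minUniformLaw,
      ← intervalIntegral.integral_add_adjacent_intervals (hint 0 _) (hint _ 1)]
    exact le_add_of_nonneg_left (intervalIntegral.integral_nonneg hinv.1 fun u hu =>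
      mul_nonneg (minUniform_density_nonneg (hu.2.trans hinv.2)) hu.1)
  calc ∫ u in (n + 1 : ℝ)⁻¹..1, n * (1 - u) ^ (n - 1) * Real.log ((n + 1) * u) ^ 2
      ≤ ∫ u in (n + 1 : ℝ)⁻¹..1, 4 * (n + 1) * (n * (1 - u) ^ (n - 1) * u) :=
        intervalIntegral.integral_mono_on hinv.2
          (intervalIntegrable_log_sq_minUniform hinv ⟨zero_le_one, le_rfl⟩)
          ((hint _ _).const_mul _) hpoint
    _ = 4 * (n + 1) * ∫ u in (n + 1 : ℝ)⁻¹..1, n * (1 - u) ^ (n - 1) * u :=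
        intervalIntegral.integral_const_mul _ _
    _ ≤ 4 * (n + 1) * (1 / (n + 1)) := by gcongr
    _ = 4 := by field_simp

lemma integral_log_mul_sq_minUniformLaw_le (hn : n ≠ 0) :
    ∫ u, Real.log (((n : ℝ) + 1) * u) ^ 2 ∂(minUniformLaw n) ≤ 36 := by
  have hinv := inv_cast_add_one_mem_Icc n
  rw [integral_minUniformLaw, ← intervalIntegral.integral_add_adjacent_intervals
    (intervalIntegrable_log_sq_minUniform ⟨le_rfl, zero_le_one⟩ hinv)
    (intervalIntegrable_log_sq_minUniform hinv ⟨zero_le_one, le_rfl⟩)]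
  linarith [intervalIntegral_log_sq_minUniform_left_le n,
    intervalIntegral_log_sq_minUniform_right_le hn]

end MinUniform

section BallProbability

variable {E : Type*}

/-- The probability under `μ` of the closed ball of radius `r` around `x`. -/
noncomputable def ballProb [PseudoMetricSpace E] [MeasurableSpace E] (μ : Measure E) (x : E)
    (r : ℝ) : ℝ :=
  μ.real (Metric.closedBall x r)

section PseudoMetricSpace

variable [PseudoMetricSpace E] [MeasurableSpace E] {μ : Measure E}

lemma ballProb_nonneg (x : E) (r : ℝ) : 0 ≤ ballProb μ x r :=
  measureReal_nonneg

lemma ballProb_le_one [IsProbabilityMeasure μ] (x : E) (r : ℝ) : ballProb μ x r ≤ 1 :=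
  measureReal_le_one

lemma monotone_ballProb [IsFiniteMeasure μ] (x : E) : Monotone (ballProb μ x) := fun _ _ hrs =>
  measureReal_mono (Metric.closedBall_subset_closedBall hrs)

lemma log_ballProb_nonpos [IsProbabilityMeasure μ] (x : E) (r : ℝ) :
    Real.log (ballProb μ x r) ≤ 0 :=
  Real.log_nonpos (ballProb_nonneg x r) (ballProb_le_one x r)

variable [BorelSpace E]

@[fun_prop]
lemma measurable_ballProb [SecondCountableTopology E] [SFinite μ] :
    Measurable fun p : E × ℝ => ballProb μ p.1 p.2 := by
  have hs : MeasurableSet {q : (E × ℝ) × E | dist q.2 q.1.1 ≤ q.1.2} :=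
    measurableSet_le (by fun_prop) (by fun_prop)
  exact (measurable_measure_prodMk_left hs).ennreal_toReal

lemma ballProb_eq_cdf [IsProbabilityMeasure μ] (x : E) :
    ballProb μ x = cdf (μ.map fun z => dist z x) := by
  have hdist : Measurable fun z : E => dist z x := (continuous_id.dist continuous_const).measurable
  have := Measure.isProbabilityMeasure_map (μ := μ) hdist.aemeasurable
  ext r
  rw [cdf_eq_real, map_measureReal_apply hdist measurableSet_Iic]
  rfl

lemma tendsto_ballProb_atTop [IsProbabilityMeasure μ] (x : E) :
    Tendsto (ballProb μ x) atTop (𝓝 1) := by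
  rw [ballProb_eq_cdf]
  exact tendsto_cdf_atTop _

end PseudoMetricSpace

variable [NormedAddCommGroup E] [InnerProductSpace ℝ E] [FiniteDimensional ℝ E]
  [MeasurableSpace E] [BorelSpace E] {μ : Measure E} {f : E → ℝ}

/-- The logarithm of the average density of `μ` with respect to the volume on the closed ball of
radius `r` around `x`. -/
noncomputable def logBallDensity (μ : Measure E) (x : E) (r : ℝ) : ℝ :=
  Real.log (ballProb μ x r) - Real.log (ballProb volume x r)

lemma measurable_logBallDensity [SFinite μ] :
    Measurable fun p : E × ℝ => logBallDensity μ p.1 p.2 :=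
  measurable_ballProb.log.sub measurable_ballProb.log

lemma ballProb_volume_pos (x : E) {r : ℝ} (hr : 0 < r) : 0 < ballProb volume x r :=
  ENNReal.toReal_pos (Metric.measure_closedBall_pos _ _ hr).ne' measure_closedBall_lt_top.ne

lemma log_ballProb_volume (x : E) {r : ℝ} (hr : 0 < r) :
    Real.log (ballProb volume x r) =
      Module.finrank ℝ E * Real.log r + Real.log (ballProb volume (0 : E) 1) := by
  have hscale : ballProb volume x r = r ^ Module.finrank ℝ E * ballProb volume (0 : E) 1 :=
    Measure.addHaar_real_closedBall' _ _ hr.le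
  rw [hscale, Real.log_mul (pow_pos hr _).ne' (ballProb_volume_pos _ one_pos).ne', Real.log_pow]

/-- The law `μ` has a continuous positive density `f` whose logarithm grows at most
quadratically: the regularity under which the entropy estimates are shown to be consistent. -/
structure HasLogQuadraticDensity (μ : Measure E) (f : E → ℝ) : Prop where
  eq_withDensity : μ = volume.withDensity fun x => ENNReal.ofReal (f x)
  continuous : Continuous f
  pos : ∀ x, 0 < f x
  exists_abs_log_le : ∃ K : ℝ, ∀ x, |Real.log (f x)| ≤ K * (1 + ‖x‖ ^ 2)

namespace HasLogQuadraticDensity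

lemma continuous_log (h : HasLogQuadraticDensity μ f) : Continuous fun x => Real.log (f x) :=
  h.continuous.log fun x => (h.pos x).ne'

lemma absolutelyContinuous (h : HasLogQuadraticDensity μ f) : μ ≪ volume := by
  rw [h.eq_withDensity]
  exact withDensity_absolutelyContinuous _ _

lemma isOpenPosMeasure (h : HasLogQuadraticDensity μ f) : μ.IsOpenPosMeasure := by
  have : (volume : Measure E) ≪ μ := by
    rw [h.eq_withDensity]
    exact withDensity_absolutelyContinuous' h.continuous.measurable.ennreal_ofReal.aemeasurable
      (Eventually.of_forall fun x => by simpa using h.pos x)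
  exact this.isOpenPosMeasure

lemma nullSingletonClass [Nontrivial E] (h : HasLogQuadraticDensity μ f) : NullSingletonClass μ :=
  ⟨fun x => h.absolutelyContinuous (measure_singleton x)⟩

lemma ballProb_le_mul_ballProb_volume (h : HasLogQuadraticDensity μ f) {x : E} {r c : ℝ}
    (hc : 0 ≤ c) (hcf : ∀ z ∈ Metric.closedBall x r, f z ≤ c) :
    ballProb μ x r ≤ c * ballProb volume x r := by
  have hle : μ (Metric.closedBall x r) ≤ ENNReal.ofReal c * volume (Metric.closedBall x r) := by
    rw [h.eq_withDensity, withDensity_apply _ measurableSet_closedBall, ← setLIntegral_const]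
    exact setLIntegral_mono' measurableSet_closedBall fun z hz =>
      ENNReal.ofReal_le_ofReal (hcf z hz)
  simpa [hc, ballProb, measureReal_def] using ENNReal.toReal_mono
    (ENNReal.mul_ne_top ENNReal.ofReal_ne_top measure_closedBall_lt_top.ne) hle

section IsFiniteMeasure

variable [IsFiniteMeasure μ]

lemma mul_ballProb_volume_le (h : HasLogQuadraticDensity μ f) {x : E} {r c : ℝ} (hc : 0 ≤ c)
    (hcf : ∀ z ∈ Metric.closedBall x r, c ≤ f z) : c * ballProb volume x r ≤ ballProb μ x r := by
  have hle : ENNReal.ofReal c * volume (Metric.closedBall x r) ≤ μ (Metric.closedBall x r) := by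
    rw [h.eq_withDensity, withDensity_apply _ measurableSet_closedBall, ← setLIntegral_const]
    exact setLIntegral_mono' measurableSet_closedBall fun z hz =>
      ENNReal.ofReal_le_ofReal (hcf z hz)
  simpa [hc, ballProb, measureReal_def] using ENNReal.toReal_mono (measure_ne_top _ _) hle

lemma abs_logBallDensity_sub_le (h : HasLogQuadraticDensity μ f) {x : E} {r a b : ℝ} (hr : 0 < r)
    (hb : ∀ z ∈ Metric.closedBall x r, |Real.log (f z) - a| ≤ b) :
    |logBallDensity μ x r - a| ≤ b := by
  have hvol := ballProb_volume_pos x hr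
  have hlow : Real.exp (a - b) * ballProb volume x r ≤ ballProb μ x r :=
    h.mul_ballProb_volume_le (Real.exp_pos _).le fun z hz => by
      rw [← Real.le_log_iff_exp_le (h.pos z)]
      linarith [(abs_le.1 (hb z hz)).1]
  have hup : ballProb μ x r ≤ Real.exp (a + b) * ballProb volume x r :=
    h.ballProb_le_mul_ballProb_volume (Real.exp_pos _).le fun z hz => by
      rw [← Real.log_le_iff_le_exp (h.pos z)]
      linarith [(abs_le.1 (hb z hz)).2]
  have hlogLow := Real.log_le_log (by positivity) hlow
  have hlogUp := Real.log_le_log ((mul_pos (Real.exp_pos _) hvol).trans_le hlow) hup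
  rw [Real.log_mul (Real.exp_pos _).ne' hvol.ne', Real.log_exp] at hlogLow hlogUp
  rw [logBallDensity, abs_le]
  constructor <;> linarith

lemma exists_abs_logBallDensity_le (h : HasLogQuadraticDensity μ f) :
    ∃ K : ℝ, ∀ x r, 0 < r → |logBallDensity μ x r| ≤ K * (1 + ‖x‖ ^ 2 + r ^ 2) := by
  obtain ⟨K, hK⟩ := h.exists_abs_log_le
  have hK0 : 0 ≤ K := by simpa using (abs_nonneg _).trans (hK 0)
  refine ⟨2 * K, fun x r hr => ?_⟩
  rw [← sub_zero (logBallDensity μ x r)]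
  refine h.abs_logBallDensity_sub_le hr fun z hz => ?_
  have hnorm : ‖z‖ ≤ ‖x‖ + r := by
    linarith [norm_le_norm_add_norm_sub' z x, mem_closedBall_iff_norm.1 hz]
  have hsq : ‖z‖ ^ 2 ≤ 2 * ‖x‖ ^ 2 + 2 * r ^ 2 :=
    (pow_le_pow_left₀ (norm_nonneg z) hnorm 2).trans (by linarith [sq_nonneg (‖x‖ - r)])
  calc |Real.log (f z) - 0| ≤ K * (1 + ‖z‖ ^ 2) := (congrArg _ (sub_zero _)).trans_le (hK z)
    _ ≤ K * (2 * (1 + ‖x‖ ^ 2 + r ^ 2)) := by gcongr; linarith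
    _ = 2 * K * (1 + ‖x‖ ^ 2 + r ^ 2) := by ring

lemma tendsto_logBallDensity (h : HasLogQuadraticDensity μ f) (x : E) :
    Tendsto (logBallDensity μ x) (𝓝[>] 0) (𝓝 (Real.log (f x))) := by
  rw [Metric.tendsto_nhds]
  intro ε hε
  obtain ⟨δ, hδ, hball⟩ := Metric.continuousAt_iff.1 (h.continuous_log.continuousAt (x := x))
    (ε / 2) (half_pos hε)
  filter_upwards [Ioo_mem_nhdsGT hδ] with r hr
  refine (h.abs_logBallDensity_sub_le hr.1 fun z hz => ?_).trans_lt (half_lt_self hε)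
  exact (hball ((Metric.mem_closedBall.1 hz).trans_lt hr.2)).le

variable [Nontrivial E]

lemma strictMonoOn_ballProb (h : HasLogQuadraticDensity μ f) (x : E) :
    StrictMonoOn (ballProb μ x) (Set.Ici 0) := by
  intro r (hr : 0 ≤ r) s _ hrs
  have := h.isOpenPosMeasure
  obtain ⟨z, hz⟩ := exists_norm_eq E (c := (r + s) / 2) (by linarith)
  have hopen : IsOpen (Metric.ball x s \ Metric.closedBall x r) :=
    Metric.isOpen_ball.sdiff Metric.isClosed_closedBall
  have hmem : x + z ∈ Metric.ball x s \ Metric.closedBall x r := by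
    simp only [Set.mem_sdiff, Metric.mem_ball, Metric.mem_closedBall, dist_self_add_left, hz]
    constructor <;> linarith
  have hpos : 0 < μ.real (Metric.ball x s \ Metric.closedBall x r) :=
    ENNReal.toReal_pos (hopen.measure_pos μ ⟨_, hmem⟩).ne' (measure_ne_top _ _)
  have hadd : μ.real (Metric.ball x s \ Metric.closedBall x r) + ballProb μ x r ≤
      ballProb μ x s := by
    rw [ballProb, ← measureReal_union Set.disjoint_sdiff_left measurableSet_closedBall]
    exact measureReal_mono (Set.union_subset (Set.sdiff_subset.trans Metric.ball_subset_closedBall)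
      (Metric.closedBall_subset_closedBall hrs.le))
  linarith

lemma ballProb_of_nonpos (h : HasLogQuadraticDensity μ f) (x : E) {r : ℝ} (hr : r ≤ 0) :
    ballProb μ x r = 0 := by
  have := h.nullSingletonClass
  refine le_antisymm ((monotone_ballProb x hr).trans_eq ?_) (ballProb_nonneg x r)
  simp [ballProb, measureReal_def, measure_singleton x]

lemma ballProb_pos_iff (h : HasLogQuadraticDensity μ f) {x : E} {r : ℝ} :
    0 < ballProb μ x r ↔ 0 < r := by
  refine ⟨fun hp => ?_, fun hr => ?_⟩
  · contrapose! hp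
    exact (h.ballProb_of_nonpos x hp).le
  · exact (ballProb_nonneg x 0).trans_lt (h.strictMonoOn_ballProb x Set.self_mem_Ici hr.le hr)

end IsFiniteMeasure

variable [IsProbabilityMeasure μ]

lemma continuous_ballProb [Nontrivial E] (h : HasLogQuadraticDensity μ f) (x : E) :
    Continuous (ballProb μ x) := by
  rw [ballProb_eq_cdf]
  set m := μ.map fun z => dist z x with hm
  refine continuous_iff_continuousAt.2 fun r => ?_
  rw [(cdf m).mono.continuousAt_iff_leftLim_eq_rightLim, (cdf m).rightLim_eq]
  have hdist : Measurable fun z : E => dist z x := by fun_prop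
  have := Measure.isProbabilityMeasure_map (μ := μ) hdist.aemeasurable
  have hsphere : (cdf m).measure {r} = 0 := by
    rw [measure_cdf, hm, Measure.map_apply hdist (measurableSet_singleton r)]
    exact h.absolutelyContinuous (Measure.addHaar_sphere volume x r)
  rw [StieltjesFunction.measure_singleton, ENNReal.ofReal_eq_zero] at hsphere
  exact le_antisymm ((cdf m).mono.leftLim_le le_rfl) (by linarith)

lemma exists_lt_ballProb_iff [Nontrivial E] (h : HasLogQuadraticDensity μ f) (x : E) {u : ℝ}
    (hu : u ∈ Set.Ico (0 : ℝ) 1) :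
    ∃ r, ballProb μ x r = u ∧ ∀ s, u < ballProb μ x s ↔ r < s := by
  obtain ⟨R, hR, hR0⟩ := (((tendsto_ballProb_atTop (μ := μ) x).eventually
    (eventually_gt_nhds hu.2)).and (eventually_ge_atTop 0)).exists
  obtain ⟨r, hr, rfl⟩ := intermediate_value_Icc hR0 (h.continuous_ballProb x).continuousOn
    ⟨(h.ballProb_of_nonpos x le_rfl).trans_le hu.1, hR.le⟩
  refine ⟨r, rfl, fun s => ⟨fun hs => ?_, fun hs => ?_⟩⟩
  · exact (monotone_ballProb x).reflect_lt hs
  · exact h.strictMonoOn_ballProb x hr.1 (hr.1.trans hs.le) hs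

end HasLogQuadraticDensity

end BallProbability

section NegativeDependence

variable {Ω : Type*} [MeasurableSpace Ω] {Q : Measure Ω}

lemma lintegral_mul_le_of_tail_le [IsFiniteMeasure Q] {G K : Ω → ℝ} (hG : Measurable G)
    (hK : Measurable K) (hG0 : 0 ≤ᵐ[Q] G) (hK0 : 0 ≤ᵐ[Q] K)
    (h : ∀ s > 0, ∀ t > 0, Q ({ω | s ≤ G ω} ∩ {ω | t ≤ K ω}) ≤
      Q {ω | s ≤ G ω} * Q {ω | t ≤ K ω}) :
    ∫⁻ ω, ENNReal.ofReal (G ω) * ENNReal.ofReal (K ω) ∂Q ≤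
      (∫⁻ ω, ENNReal.ofReal (G ω) ∂Q) * ∫⁻ ω, ENNReal.ofReal (K ω) ∂Q := by
  have hstep : ∀ s > 0, ∫⁻ ω in {ω | s ≤ G ω}, ENNReal.ofReal (K ω) ∂Q ≤
      Q {ω | s ≤ G ω} * ∫⁻ ω, ENNReal.ofReal (K ω) ∂Q := by
    intro s hs
    rw [lintegral_eq_lintegral_meas_le _ (ae_restrict_of_ae hK0) hK.aemeasurable,
      lintegral_eq_lintegral_meas_le _ hK0 hK.aemeasurable,
      ← lintegral_const_mul' _ _ (measure_ne_top _ _)]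
    refine setLIntegral_mono' measurableSet_Ioi fun t ht => ?_
    rw [Measure.restrict_apply (measurableSet_le measurable_const hK), Set.inter_comm]
    exact h s hs t ht
  have htail : AEMeasurable (fun s : ℝ => Q {ω | s ≤ G ω}) (volume.restrict (Set.Ioi 0)) :=
    (Antitone.measurable fun _ b hab => measure_mono fun ω (hω : b ≤ G ω) =>
      hab.trans hω).aemeasurable
  calc ∫⁻ ω, ENNReal.ofReal (G ω) * ENNReal.ofReal (K ω) ∂Q
      = ∫⁻ ω, ENNReal.ofReal (G ω) ∂(Q.withDensity fun ω => ENNReal.ofReal (K ω)) := by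
        rw [lintegral_withDensity_eq_lintegral_mul _ hK.ennreal_ofReal hG.ennreal_ofReal]
        simp only [Pi.mul_apply, mul_comm]
    _ = ∫⁻ s in Set.Ioi (0 : ℝ), ∫⁻ ω in {ω | s ≤ G ω}, ENNReal.ofReal (K ω) ∂Q := by
        rw [lintegral_eq_lintegral_meas_le _
          ((withDensity_absolutelyContinuous _ _).ae_le hG0) hG.aemeasurable]
        simp only [withDensity_apply _ (measurableSet_le measurable_const hG)]
    _ ≤ ∫⁻ s in Set.Ioi (0 : ℝ), Q {ω | s ≤ G ω} * ∫⁻ ω, ENNReal.ofReal (K ω) ∂Q :=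
        setLIntegral_mono' measurableSet_Ioi hstep
    _ = (∫⁻ ω, ENNReal.ofReal (G ω) ∂Q) * ∫⁻ ω, ENNReal.ofReal (K ω) ∂Q := by
        rw [lintegral_mul_const'' _ htail, ← lintegral_eq_lintegral_meas_le _ hG0 hG.aemeasurable]

lemma integral_mul_le_of_tail_le [IsFiniteMeasure Q] {G K : Ω → ℝ} (hG : Measurable G)
    (hK : Measurable K) (hG0 : 0 ≤ᵐ[Q] G) (hK0 : 0 ≤ᵐ[Q] K) (hGL : MemLp G 2 Q) (hKL : MemLp K 2 Q)
    (h : ∀ s > 0, ∀ t > 0, Q ({ω | s ≤ G ω} ∩ {ω | t ≤ K ω}) ≤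
      Q {ω | s ≤ G ω} * Q {ω | t ≤ K ω}) :
    ∫ ω, G ω * K ω ∂Q ≤ (∫ ω, G ω ∂Q) * ∫ ω, K ω ∂Q := by
  have hGI := hGL.integrable one_le_two
  have hKI := hKL.integrable one_le_two
  have hprod : ENNReal.ofReal (∫ ω, G ω * K ω ∂Q) =
      ∫⁻ ω, ENNReal.ofReal (G ω) * ENNReal.ofReal (K ω) ∂Q := by
    have hGKI : Integrable (fun ω => G ω * K ω) Q := hGL.integrable_mul hKL
    rw [ofReal_integral_eq_lintegral_ofReal hGKI
      (by filter_upwards [hG0, hK0] with ω using mul_nonneg)]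
    exact lintegral_congr_ae (hG0.mono fun ω hω => ENNReal.ofReal_mul hω)
  rw [← ENNReal.ofReal_le_ofReal_iff
      (mul_nonneg (integral_nonneg_of_ae hG0) (integral_nonneg_of_ae hK0)),
    ENNReal.ofReal_mul (integral_nonneg_of_ae hG0), hprod,
    ofReal_integral_eq_lintegral_ofReal hGI hG0, ofReal_integral_eq_lintegral_ofReal hKI hK0]
  exact lintegral_mul_le_of_tail_le hG hK hG0 hK0 h

lemma measure_compl_inter_compl_le [IsProbabilityMeasure Q] {A B : Set Ω}
    (hA : MeasurableSet A) (hB : MeasurableSet B)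
    (h : Q (A ∩ B) ≤ Q A * Q B) : Q (Aᶜ ∩ Bᶜ) ≤ Q Aᶜ * Q Bᶜ := by
  have hreal : Q.real (A ∩ B) ≤ Q.real A * Q.real B := by
    simpa [measureReal_def] using ENNReal.toReal_mono (by finiteness) h
  rw [← ENNReal.toReal_le_toReal (by finiteness) (by finiteness), ENNReal.toReal_mul,
    ← Set.compl_union]
  change Q.real _ ≤ Q.real _ * Q.real _
  rw [probReal_compl_eq_one_sub (hA.union hB), probReal_compl_eq_one_sub hA,
    probReal_compl_eq_one_sub hB]
  linarith [measureReal_union_add_inter (μ := Q) (s := A) hB]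

lemma setOf_le_neg_log_ae_eq {V : Ω → ℝ} (hV : ∀ᵐ ω ∂Q, 0 < V ω) (s : ℝ) :
    {ω | s ≤ -Real.log (V ω)} =ᵐ[Q] {ω | Real.exp (-s) < V ω}ᶜ := by
  filter_upwards [hV] with ω hω
  refine propext (?_ : s ≤ -Real.log (V ω) ↔ ¬ Real.exp (-s) < V ω)
  rw [not_lt, ← Real.log_le_iff_le_exp hω, le_neg]

lemma covariance_log_log_nonpos [IsProbabilityMeasure Q] {W Z : Ω → ℝ}
    (hW : Measurable W) (hZ : Measurable Z)
    (hW1 : ∀ ω, W ω ≤ 1) (hZ1 : ∀ ω, Z ω ≤ 1)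
    (hW0 : ∀ᵐ ω ∂Q, 0 < W ω) (hZ0 : ∀ᵐ ω ∂Q, 0 < Z ω)
    (hWL : MemLp (fun ω => Real.log (W ω)) 2 Q) (hZL : MemLp (fun ω => Real.log (Z ω)) 2 Q)
    (h : ∀ u ∈ Set.Ioo (0 : ℝ) 1, ∀ v ∈ Set.Ioo (0 : ℝ) 1,
      Q ({ω | u < W ω} ∩ {ω | v < Z ω}) ≤ Q {ω | u < W ω} * Q {ω | v < Z ω}) :
    cov[fun ω => Real.log (W ω), fun ω => Real.log (Z ω); Q] ≤ 0 := by
  have hexp : ∀ s > 0, Real.exp (-s) ∈ Set.Ioo (0 : ℝ) 1 := fun s hs =>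
    ⟨Real.exp_pos _, Real.exp_lt_one_iff.2 (neg_lt_zero.2 hs)⟩
  have key := integral_mul_le_of_tail_le (Q := Q)
    (G := fun ω => -Real.log (W ω)) (K := fun ω => -Real.log (Z ω)) hW.log.neg hZ.log.neg
    (hW0.mono fun ω hω => neg_nonneg.2 (Real.log_nonpos hω.le (hW1 ω)))
    (hZ0.mono fun ω hω => neg_nonneg.2 (Real.log_nonpos hω.le (hZ1 ω))) hWL.neg hZL.neg
    fun s hs t ht => by
      rw [measure_congr ((setOf_le_neg_log_ae_eq hW0 s).inter (setOf_le_neg_log_ae_eq hZ0 t)),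
        measure_congr (setOf_le_neg_log_ae_eq hW0 s), measure_congr (setOf_le_neg_log_ae_eq hZ0 t)]
      exact measure_compl_inter_compl_le (measurableSet_lt measurable_const hW)
        (measurableSet_lt measurable_const hZ) (h _ (hexp s hs) _ (hexp t ht))
  rw [covariance_eq_sub hWL hZL, sub_nonpos]
  simpa only [Pi.mul_apply, neg_mul_neg, integral_neg] using key

end NegativeDependence

section MinDist

variable {ι E : Type*}

/-- The distance from `x` to the nearest point of the finite family `z` (zero if `z` is empty). -/
noncomputable def minDist [PseudoMetricSpace E] (x : E) (z : ι → E) : ℝ := ⨅ j, dist x (z j)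

section Finite

variable [PseudoMetricSpace E] [Finite ι]

lemma exists_dist_eq_minDist [Nonempty ι] (x : E) (z : ι → E) : ∃ j, dist x (z j) = minDist x z :=
  exists_eq_ciInf_of_finite

lemma minDist_le (x : E) (z : ι → E) (j : ι) : minDist x z ≤ dist x (z j) :=
  ciInf_le (Set.finite_range _).bddBelow j

lemma lt_minDist_iff [Nonempty ι] {x : E} {z : ι → E} {r : ℝ} :
    r < minDist x z ↔ ∀ j, r < dist x (z j) := by
  refine ⟨fun h j => h.trans_le (minDist_le x z j), fun h => ?_⟩
  obtain ⟨j, hj⟩ := exists_dist_eq_minDist x z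
  exact hj ▸ h j

lemma measurable_minDist [MeasurableSpace E] [BorelSpace E] [SecondCountableTopology E] :
    Measurable fun p : E × (ι → E) => minDist p.1 p.2 :=
  Measurable.iInf fun j => by fun_prop

end Finite

variable [PseudoMetricSpace E] [Fintype ι] [Nonempty ι] [MeasurableSpace E] [BorelSpace E]
  {μ : Measure E} [IsProbabilityMeasure μ]

lemma pi_lt_minDist (x : E) (r : ℝ) :
    Measure.pi (fun _ : ι => μ) {z | r < minDist x z} =
      ENNReal.ofReal ((1 - ballProb μ x r) ^ Fintype.card ι) := by
  have hset : {z : ι → E | r < minDist x z} =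
      Set.univ.pi fun _ : ι => (Metric.closedBall x r)ᶜ := by
    ext z
    simp [lt_minDist_iff, dist_comm x]
  rw [hset, Measure.pi_pi, Finset.prod_const, Finset.card_univ, ← ofReal_measureReal,
    ← ENNReal.ofReal_pow measureReal_nonneg, probReal_compl_eq_one_sub measurableSet_closedBall,
    ballProb]

lemma pi_lt_minDist_inter_le {x y : E} {r s : ℝ} (hrs : r + s < dist x y) :
    Measure.pi (fun _ : ι => μ) ({z | r < minDist x z} ∩ {z | s < minDist y z}) ≤
      Measure.pi (fun _ : ι => μ) {z | r < minDist x z} *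
        Measure.pi (fun _ : ι => μ) {z | s < minDist y z} := by
  have hset : {z : ι → E | r < minDist x z} ∩ {z | s < minDist y z} =
      Set.univ.pi fun _ : ι => (Metric.closedBall x r ∪ Metric.closedBall y s)ᶜ := by
    ext z
    simp [lt_minDist_iff, dist_comm x, dist_comm y, forall_and]
  have hunion : μ.real (Metric.closedBall x r ∪ Metric.closedBall y s)ᶜ =
      1 - (ballProb μ x r + ballProb μ y s) := by
    rw [probReal_compl_eq_one_sub (measurableSet_closedBall.union measurableSet_closedBall),
      measureReal_union (Metric.closedBall_disjoint_closedBall hrs) measurableSet_closedBall]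
    rfl
  have hx := ballProb_nonneg (μ := μ) x r
  have hy := ballProb_nonneg (μ := μ) y s
  rw [pi_lt_minDist, pi_lt_minDist, hset, Measure.pi_pi, Finset.prod_const, Finset.card_univ,
    ← ofReal_measureReal, ← ENNReal.ofReal_pow measureReal_nonneg,
    ← ENNReal.ofReal_mul (pow_nonneg (sub_nonneg.2 (ballProb_le_one x r)) _), ← mul_pow]
  refine ENNReal.ofReal_le_ofReal (pow_le_pow_left₀ measureReal_nonneg ?_ _)
  rw [hunion]
  nlinarith [mul_nonneg hx hy]

end MinDist

section SecondMoments

variable {Ω E : Type*} [MeasurableSpace Ω] [NormedAddCommGroup E] {P : Measure Ω}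
  {a b r s : Ω → ℝ}

lemma memLp_norm_sq_of_memLp_four {g : Ω → E} (hg : MemLp g 4 P) :
    MemLp (fun ω => ‖g ω‖ ^ 2) 2 P := by
  have hexp : (4 : ENNReal) / 2 = 2 := by
    rw [show (4 : ENNReal) = 2 * 2 by norm_num,
      ENNReal.mul_div_cancel_right two_ne_zero ENNReal.ofNat_ne_top]
  simpa [hexp] using hg.norm_rpow_div 2

lemma sq_integral_le_integral_sq [IsProbabilityMeasure P] (ha : MemLp a 2 P) :
    (∫ ω, a ω ∂P) ^ 2 ≤ ∫ ω, a ω ^ 2 ∂P := by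
  have h := variance_nonneg a P
  rw [variance_eq_sub ha] at h
  simpa using h

lemma integral_add_sq_le (ha : MemLp a 2 P) (hb : MemLp b 2 P) :
    ∫ ω, (a ω + b ω) ^ 2 ∂P ≤ 2 * ∫ ω, a ω ^ 2 ∂P + 2 * ∫ ω, b ω ^ 2 ∂P := by
  rw [← integral_const_mul, ← integral_const_mul, ← integral_add (ha.integrable_sq.const_mul 2)
    (hb.integrable_sq.const_mul 2)]
  refine integral_mono (ha.add hb).integrable_sq
    ((ha.integrable_sq.const_mul 2).add (hb.integrable_sq.const_mul 2)) fun ω => ?_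
  simpa only [Pi.add_apply, mul_add] using add_sq_le (a := a ω) (b := b ω)

lemma integral_mul_le_sqrt_mul_sqrt (ha : MemLp a 2 P) (hb : MemLp b 2 P) :
    ∫ ω, a ω * b ω ∂P ≤ √(∫ ω, a ω ^ 2 ∂P) * √(∫ ω, b ω ^ 2 ∂P) := by
  have holder := integral_mul_norm_le_Lp_mul_Lq (μ := P) (f := a) (g := b)
    Real.HolderConjugate.two_two (by simpa using ha) (by simpa using hb)
  have hnorm : ∫ ω, a ω * b ω ∂P ≤ ∫ ω, ‖a ω‖ * ‖b ω‖ ∂P := by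
    refine integral_mono (ha.integrable_mul hb) (ha.norm.integrable_mul hb.norm) fun ω => ?_
    simpa only [← norm_mul] using Real.le_norm_self (a ω * b ω)
  refine hnorm.trans (holder.trans_eq ?_)
  simp [Real.sqrt_eq_rpow]

lemma integral_add_mul_add_le (ha : MemLp a 2 P) (hb : MemLp b 2 P) (hr : MemLp r 2 P)
    (hs : MemLp s 2 P) :
    ∫ ω, (a ω + r ω) * (b ω + s ω) ∂P ≤
      ∫ ω, a ω * b ω ∂P + √(∫ ω, a ω ^ 2 ∂P) * √(∫ ω, s ω ^ 2 ∂P) +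
        √(∫ ω, r ω ^ 2 ∂P) * √(∫ ω, b ω ^ 2 ∂P) + √(∫ ω, r ω ^ 2 ∂P) * √(∫ ω, s ω ^ 2 ∂P) := by
  have hab : Integrable (fun ω => a ω * b ω) P := ha.integrable_mul hb
  have has : Integrable (fun ω => a ω * s ω) P := ha.integrable_mul hs
  have hrb : Integrable (fun ω => r ω * b ω) P := hr.integrable_mul hb
  have hrs : Integrable (fun ω => r ω * s ω) P := hr.integrable_mul hs
  calc ∫ ω, (a ω + r ω) * (b ω + s ω) ∂P
      = ∫ ω, (a ω * b ω + a ω * s ω + r ω * b ω + r ω * s ω) ∂P := by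
        congr 1 with ω
        ring
    _ = ∫ ω, a ω * b ω ∂P + ∫ ω, a ω * s ω ∂P + ∫ ω, r ω * b ω ∂P + ∫ ω, r ω * s ω ∂P := by
        rw [integral_add ?_ hrs, integral_add ?_ hrb, integral_add hab has]
        exacts [hab.add has, (hab.add has).add hrb]
    _ ≤ _ := by
        gcongr <;> exact integral_mul_le_sqrt_mul_sqrt ‹_› ‹_›

lemma integral_add_mul_add_le_of_covariance_nonpos [IsProbabilityMeasure P] {k m : ℝ}
    (ha : MemLp a 2 P) (hb : MemLp b 2 P) (hr : MemLp r 2 P) (hs : MemLp s 2 P)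
    (hcov : cov[a, b; P] ≤ 0) (hrm : ∫ ω, r ω ∂P = m) (hsm : ∫ ω, s ω ∂P = m) :
    ∫ ω, (k + a ω) * (k + b ω) ∂P ≤
      2 * (k + m) ^ 2 + ∫ ω, (a ω - r ω) ^ 2 ∂P + ∫ ω, (b ω - s ω) ^ 2 ∂P := by
  have mean_sq_le : ∀ {u v : Ω → ℝ}, MemLp u 2 P → MemLp v 2 P → ∫ ω, v ω ∂P = m →
      (∫ ω, (k + u ω) ∂P) ^ 2 ≤ 2 * (k + m) ^ 2 + 2 * ∫ ω, (u ω - v ω) ^ 2 ∂P := by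
    intro u v hu hv hvm
    have hI := hu.integrable one_le_two
    have hle : (∫ ω, (u ω - v ω) ∂P) ^ 2 ≤ _ := sq_integral_le_integral_sq (hu.sub hv)
    have hmean : ∫ ω, (k + u ω) ∂P = (k + m) + ∫ ω, (u ω - v ω) ∂P := by
      rw [integral_add (integrable_const k) hI, integral_sub hI (hv.integrable one_le_two), hvm]
      simp
    rw [hmean]
    refine add_sq_le.trans ?_
    rw [mul_add]
    gcongr
  have hka : MemLp (fun ω => k + a ω) 2 P := (memLp_const k).add ha
  have hkb : MemLp (fun ω => k + b ω) 2 P := (memLp_const k).add hb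
  have hprod : ∫ ω, (k + a ω) * (k + b ω) ∂P =
      cov[a, b; P] + (∫ ω, (k + a ω) ∂P) * ∫ ω, (k + b ω) ∂P := by
    rw [← covariance_const_add_left (ha.integrable one_le_two) k,
      ← covariance_const_add_right (hb.integrable one_le_two) k, covariance_eq_sub hka hkb]
    simp
  rw [hprod]
  linarith [mean_sq_le ha hr hrm, mean_sq_le hb hs hsm,
    two_mul_le_add_sq (∫ ω, (k + a ω) ∂P) (∫ ω, (k + b ω) ∂P)]

lemma tendsto_integral_sq_of_dominated {g : ℕ → Ω → ℝ} {G : Ω → ℝ} (hG : MemLp G 2 P)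
    (hm : ∀ n, AEStronglyMeasurable (g n) P) (hb : ∀ n, ∀ᵐ ω ∂P, |g n ω| ≤ G ω)
    (hlim : ∀ᵐ ω ∂P, Tendsto (fun n => g n ω) atTop (𝓝 0)) :
    Tendsto (fun n => ∫ ω, g n ω ^ 2 ∂P) atTop (𝓝 0) := by
  have hdom := tendsto_integral_of_dominated_convergence (μ := P) (F := fun n ω => g n ω ^ 2)
    (f := fun _ => 0) (fun ω => G ω ^ 2) (fun n => (hm n).pow 2) hG.integrable_sq
    (fun n => (hb n).mono fun ω hω => by
      rw [norm_pow, Real.norm_eq_abs]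
      gcongr)
    (hlim.mono fun ω hω => by simpa using hω.pow 2)
  simpa using hdom

lemma integral_mean_sq_le {N : ℕ} {ξ : Fin N → Ω → ℝ} {A B : ℝ} (hN : N ≠ 0)
    (hξ : ∀ i, MemLp (ξ i) 2 P) (hA : ∀ i, ∫ ω, ξ i ω * ξ i ω ∂P ≤ A)
    (hB : ∀ i j, i ≠ j → ∫ ω, ξ i ω * ξ j ω ∂P ≤ B) (hB0 : 0 ≤ B) :
    ∫ ω, ((1 : ℝ) / N * ∑ i, ξ i ω) ^ 2 ∂P ≤ A / N + B := by
  have hI : ∀ i j, Integrable (fun ω => ξ i ω * ξ j ω) P := fun i j => (hξ i).integrable_mul (hξ j)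
  have hterm : ∀ i j, ∫ ω, ξ i ω * ξ j ω ∂P ≤ (if i = j then A else 0) + B := fun i j => by
    split_ifs with hij
    · exact hij ▸ (hA i).trans (le_add_of_nonneg_right hB0)
    · simpa using hB i j hij
  calc ∫ ω, ((1 : ℝ) / N * ∑ i, ξ i ω) ^ 2 ∂P
      = ((1 : ℝ) / N) ^ 2 * ∑ i, ∑ j, ∫ ω, ξ i ω * ξ j ω ∂P := by
        simp_rw [mul_pow, pow_two (∑ i, ξ i _), Finset.sum_mul_sum]
        rw [integral_const_mul,
          integral_finsetSum _ fun i _ => integrable_finsetSum _ fun j _ => hI i j]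
        simp_rw [integral_finsetSum _ fun j _ => hI _ j]
    _ ≤ ((1 : ℝ) / N) ^ 2 * ∑ i : Fin N, ∑ j : Fin N, ((if i = j then A else 0) + B) := by
        gcongr with i _ j _
        exact hterm i j
    _ = A / N + B := by
        simp only [Finset.sum_add_distrib, Finset.sum_ite_eq, Finset.mem_univ, if_true,
          Finset.sum_const, Finset.card_univ, Fintype.card_fin, nsmul_eq_mul]
        field_simp

lemma tendsto_integral_of_tendsto_integral_sub_sq [IsProbabilityMeasure P] {T : ℕ → Ω → ℝ}
    {c : ℝ} (hT : ∀ᶠ n in atTop, MemLp (T n) 2 P)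
    (hlim : Tendsto (fun n => ∫ ω, (T n ω - c) ^ 2 ∂P) atTop (𝓝 0)) :
    Tendsto (fun n => ∫ ω, T n ω ∂P) atTop (𝓝 c) := by
  have hsqrt := hlim.sqrt
  rw [Real.sqrt_zero] at hsqrt
  rw [tendsto_iff_dist_tendsto_zero]
  refine squeeze_zero' (Eventually.of_forall fun _ => dist_nonneg) ?_ hsqrt
  filter_upwards [hT] with n hn
  have hle := sq_integral_le_integral_sq (hn.sub (memLp_const c))
  simp only [Pi.sub_apply] at hle
  rw [integral_sub (hn.integrable one_le_two) (integrable_const c), integral_const, probReal_univ,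
    one_smul] at hle
  exact Real.abs_le_sqrt hle

end SecondMoments

section NearestProb

section Law

variable {A B C : Type*} [MeasurableSpace A] [MeasurableSpace B] [MeasurableSpace C]

lemma hasLaw_prod_of_forall {φ : A × B → C} {ν : Measure C} {μ : Measure A} {κ : Measure B}
    [IsProbabilityMeasure μ] [SFinite κ] (hφ : Measurable φ)
    (h : ∀ a, HasLaw (fun b => φ (a, b)) ν κ) : HasLaw φ ν (μ.prod κ) := by
  refine ⟨hφ.aemeasurable, Measure.ext fun s hs => ?_⟩
  have hslice : ∀ a, κ (Prod.mk a ⁻¹' (φ ⁻¹' s)) = ν s := fun a => by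
    rw [← (h a).map_eq, Measure.map_apply_of_aemeasurable (h a).aemeasurable hs]
    rfl
  rw [Measure.map_apply hφ hs, Measure.prod_apply (hφ hs)]
  simp [hslice]

lemma memLp_comp_of_hasLaw {E : Type*} [NormedAddCommGroup E] {X : A → B} {g : B → E}
    {ν : Measure B} {Q : Measure A} {p : ENNReal} (hg : MemLp g p ν) (hX : HasLaw X ν Q) :
    MemLp (fun ω => g (X ω)) p Q :=
  (hX.map_eq.symm ▸ hg).comp_of_map hX.aemeasurable

end Law

section MinUniformLaw

variable {Ω : Type*} [MeasurableSpace Ω] {P : Measure Ω} {W : Ω → ℝ} {n : ℕ}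

lemma ae_pos_of_hasLaw_minUniformLaw (hW : HasLaw W (minUniformLaw n) P) : ∀ᵐ ω ∂P, 0 < W ω :=
  ((hW.ae_iff measurableSet_Ioc.mem).2 ae_minUniformLaw_mem_Ioc).mono fun _ h => h.1

lemma memLp_log_of_hasLaw_minUniformLaw (hW : HasLaw W (minUniformLaw n) P) :
    MemLp (fun ω => Real.log (W ω)) 2 P :=
  memLp_comp_of_hasLaw memLp_log_minUniformLaw hW

lemma integral_log_of_hasLaw_minUniformLaw (hW : HasLaw W (minUniformLaw n) P) :
    ∫ ω, Real.log (W ω) ∂P = -(harmonic n : ℝ) :=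
  (hW.integral_comp Real.measurable_log.aestronglyMeasurable).trans integral_log_minUniformLaw

lemma integral_log_add_log_sq_le_of_hasLaw_minUniformLaw (hn : n ≠ 0)
    (hW : HasLaw W (minUniformLaw n) P) :
    ∫ ω, (Real.log ((n : ℝ) + 1) + Real.log (W ω)) ^ 2 ∂P ≤ 36 := by
  have hmeas : Measurable fun u : ℝ => Real.log (((n : ℝ) + 1) * u) ^ 2 := by fun_prop
  refine le_trans (le_of_eq ?_) (integral_log_mul_sq_minUniformLaw_le hn)
  rw [← hW.integral_comp hmeas.aestronglyMeasurable]
  refine integral_congr_ae ?_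
  filter_upwards [ae_pos_of_hasLaw_minUniformLaw hW] with ω hω
  rw [Function.comp_apply, Real.log_mul (by positivity) hω.ne']

end MinUniformLaw

variable {E : Type*} [NormedAddCommGroup E] [InnerProductSpace ℝ E] [FiniteDimensional ℝ E]
  [MeasurableSpace E] [BorelSpace E] {μ : Measure E} {f : E → ℝ} {ι : Type*}

/-- The logarithm of the probability of the ball around `x` that reaches to the nearest point of
the family `z`. -/
noncomputable def logNearestProb (μ : Measure E) (x : E) (z : ι → E) : ℝ :=
  Real.log (ballProb μ x (minDist x z))

/-- The variant of `logNearestProb` in which the radius is truncated at half the distance from `x`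
to `y`, so that the balls around `x` and `y` do not overlap. -/
noncomputable def logTruncatedProb (μ : Measure E) (x y : E) (z : ι → E) : ℝ :=
  Real.log (ballProb μ x (min (minDist x z) (dist x y / 2)))

/-- The effect of truncating the radius on the logarithmic ball probability. -/
noncomputable def truncationGap (μ : Measure E) (x y : E) (z : ι → E) : ℝ :=
  logTruncatedProb μ x y z - logNearestProb μ x z

/-- The error made when the probability of the truncated ball is replaced by the density at `x`
times the volume of the ball around `x` reaching to the nearest among `y` and the family `z`. -/
noncomputable def truncationError (μ : Measure E) (f : E → ℝ) (x y : E) (z : ι → E) : ℝ :=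
  Real.log (ballProb volume x (min (minDist x z) (dist x y))) + Real.log (f x) -
    logTruncatedProb μ x y z

section Measurability

variable [SFinite μ] [Finite ι]

lemma measurable_logNearestProb : Measurable fun p : E × (ι → E) => logNearestProb μ p.1 p.2 :=
  (measurable_ballProb.comp (measurable_fst.prodMk measurable_minDist)).log

lemma measurable_logTruncatedProb :
    Measurable fun p : E × E × (ι → E) => logTruncatedProb μ p.1 p.2.1 p.2.2 := by
  have hmin : Measurable fun p : E × E × (ι → E) => minDist p.1 p.2.2 :=
    measurable_minDist.comp (measurable_fst.prodMk measurable_snd.snd)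
  exact (measurable_ballProb.comp (measurable_fst.prodMk (hmin.min (by fun_prop)))).log

lemma measurable_truncationGap :
    Measurable fun p : E × E × (ι → E) => truncationGap μ p.1 p.2.1 p.2.2 :=
  measurable_logTruncatedProb.sub
    (measurable_logNearestProb.comp (measurable_fst.prodMk measurable_snd.snd))

lemma measurable_truncationError (hf : Measurable fun x => Real.log (f x)) :
    Measurable fun p : E × E × (ι → E) => truncationError μ f p.1 p.2.1 p.2.2 := by
  have hmin : Measurable fun p : E × E × (ι → E) => minDist p.1 p.2.2 :=
    measurable_minDist.comp (measurable_fst.prodMk measurable_snd.snd)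
  exact (((measurable_ballProb.comp
    (measurable_fst.prodMk (hmin.min (by fun_prop)))).log).add (hf.comp measurable_fst)).sub
    measurable_logTruncatedProb

end Measurability

variable [IsProbabilityMeasure μ] [Nontrivial E]

namespace HasLogQuadraticDensity

lemma abs_log_ballProb_sub_log_ballProb_min_le (h : HasLogQuadraticDensity μ f) {x : E}
    {r s τ : ℝ} (hτ : 0 < τ) (hs : min r τ ≤ s) (hsr : s ≤ r) :
    |Real.log (ballProb μ x s) - Real.log (ballProb μ x (min r τ))| ≤
      |Real.log (ballProb μ x τ)| := by
  rcases le_total r τ with hrτ | hτr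
  · rw [min_eq_left hrτ] at hs ⊢
    rw [le_antisymm hsr hs, sub_self, abs_zero]
    exact abs_nonneg _
  · rw [min_eq_right hτr] at hs ⊢
    have hmono := Real.log_le_log (h.ballProb_pos_iff.2 hτ) (monotone_ballProb (μ := μ) x hs)
    have hs0 := log_ballProb_nonpos (μ := μ) x s
    rw [abs_of_nonneg (sub_nonneg.2 hmono), abs_of_nonpos (hmono.trans hs0)]
    linarith

lemma abs_truncationGap_le (h : HasLogQuadraticDensity μ f) {x y : E} {z : ι → E} (hxy : x ≠ y) :
    |truncationGap μ x y z| ≤ |Real.log (ballProb μ x (dist x y / 2))| := by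
  rw [truncationGap, abs_sub_comm]
  exact h.abs_log_ballProb_sub_log_ballProb_min_le (half_pos (dist_pos.2 hxy))
    (min_le_left _ _) le_rfl

lemma exists_abs_log_volume_add_log_sub_le (h : HasLogQuadraticDensity μ f) :
    ∃ C, ∀ x r d, 0 < r → 0 < d →
      |Real.log (ballProb volume x (min r d)) + Real.log (f x) -
          Real.log (ballProb μ x (min r (d / 2)))| ≤
        C * (1 + ‖x‖ ^ 2 + d ^ 2) + |Real.log (ballProb μ x (d / 2))| := by
  obtain ⟨K, hK⟩ := h.exists_abs_logBallDensity_le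
  obtain ⟨L, hL⟩ := h.exists_abs_log_le
  refine ⟨|K| + |L|, fun x r d hr hd => ?_⟩
  have hs : 0 < min r d := lt_min hr hd
  have hbracket := h.abs_log_ballProb_sub_log_ballProb_min_le (x := x) (half_pos hd)
    (min_le_min_left r (half_le_self hd.le)) (min_le_left r d)
  have hdensity : |logBallDensity μ x (min r d)| ≤ |K| * (1 + ‖x‖ ^ 2 + d ^ 2) := by
    refine (hK x _ hs).trans ?_
    gcongr
    exacts [le_abs_self K, min_le_right r d]
  have hlog : |Real.log (f x)| ≤ |L| * (1 + ‖x‖ ^ 2 + d ^ 2) := by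
    exact (hL x).trans (mul_le_mul (le_abs_self L) (le_add_of_nonneg_right (sq_nonneg d))
      (by positivity) (abs_nonneg L))
  calc _ = |-logBallDensity μ x (min r d) + Real.log (f x) + (Real.log (ballProb μ x (min r d)) -
        Real.log (ballProb μ x (min r (d / 2))))| := by
        rw [logBallDensity]
        congr 1
        ring
    _ ≤ |K| * (1 + ‖x‖ ^ 2 + d ^ 2) + |L| * (1 + ‖x‖ ^ 2 + d ^ 2) +
        |Real.log (ballProb μ x (d / 2))| := by
        refine (abs_add_three _ _ _).trans ?_
        rw [abs_neg]
        gcongr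
    _ = _ := by ring

end HasLogQuadraticDensity

section Law

variable {Ω : Type*} [MeasurableSpace Ω] {P : Measure Ω}
  {x : Ω → E} {z : Ω → ι → E}

namespace HasLogQuadraticDensity

lemma ae_minDist_pos (h : HasLogQuadraticDensity μ f) {n : ℕ}
    (hW : HasLaw (fun ω => ballProb μ (x ω) (minDist (x ω) (z ω))) (minUniformLaw n) P) :
    ∀ᵐ ω ∂P, 0 < minDist (x ω) (z ω) := by
  filter_upwards [ae_pos_of_hasLaw_minUniformLaw hW] with ω hω
  exact h.ballProb_pos_iff.1 hω

variable [Fintype ι] [Nonempty ι]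

lemma hasLaw_ballProb_minDist (h : HasLogQuadraticDensity μ f) (x : E) :
    HasLaw (fun z : ι → E => ballProb μ x (minDist x z)) (minUniformLaw (Fintype.card ι))
      (Measure.pi fun _ => μ) := by
  refine hasLaw_minUniformLaw_of_measure_lt Fintype.card_ne_zero
    (measurable_ballProb.comp (measurable_const.prodMk
      (measurable_minDist.comp measurable_prodMk_left))) (fun z => ballProb_le_one x _)
    fun u hu => ?_
  obtain ⟨r, rfl, hr⟩ := h.exists_lt_ballProb_iff x hu
  simp_rw [hr, pi_lt_minDist]

lemma hasLaw_ballProb_minDist_comp (h : HasLogQuadraticDensity μ f)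
    (hxz : HasLaw (fun ω => (x ω, z ω)) (μ.prod (Measure.pi fun _ => μ)) P) :
    HasLaw (fun ω => ballProb μ (x ω) (minDist (x ω) (z ω))) (minUniformLaw (Fintype.card ι)) P :=
  (hasLaw_prod_of_forall
    (measurable_ballProb.comp (measurable_fst.prodMk measurable_minDist))
    fun a => h.hasLaw_ballProb_minDist a).comp hxz

end HasLogQuadraticDensity

end Law

end NearestProb

section FixedCentres

variable {E : Type*} [NormedAddCommGroup E] [InnerProductSpace ℝ E] [FiniteDimensional ℝ E]
  [MeasurableSpace E] [BorelSpace E] [Nontrivial E] {μ : Measure E} [IsProbabilityMeasure μ]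
  {f : E → ℝ} {ι : Type*} [Fintype ι] {x y : E}

namespace HasLogQuadraticDensity

lemma memLp_truncationGap_of_ne (h : HasLogQuadraticDensity μ f) (hxy : x ≠ y) :
    MemLp (fun z : ι → E => truncationGap μ x y z) 2 (Measure.pi fun _ => μ) := by
  have hp : Measurable fun z : ι → E => (x, y, z) := by fun_prop
  exact MemLp.of_bound (measurable_truncationGap.comp hp).aestronglyMeasurable
    |Real.log (ballProb μ x (dist x y / 2))|
    (Eventually.of_forall fun z => h.abs_truncationGap_le hxy)

variable [Nonempty ι]

lemma pi_lt_ballProb_truncated_inter_le (h : HasLogQuadraticDensity μ f) (x y : E) {u v : ℝ}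
    (hu : u ∈ Set.Ioo (0 : ℝ) 1) (hv : v ∈ Set.Ioo (0 : ℝ) 1) :
    Measure.pi (fun _ : ι => μ)
        ({z | u < ballProb μ x (min (minDist x z) (dist x y / 2))} ∩
          {z | v < ballProb μ y (min (minDist y z) (dist y x / 2))}) ≤
      Measure.pi (fun _ : ι => μ) {z | u < ballProb μ x (min (minDist x z) (dist x y / 2))} *
        Measure.pi (fun _ : ι => μ) {z | v < ballProb μ y (min (minDist y z) (dist y x / 2))} := by
  obtain ⟨r, -, hr⟩ := h.exists_lt_ballProb_iff x (Set.Ioo_subset_Ico_self hu)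
  obtain ⟨s, -, hs⟩ := h.exists_lt_ballProb_iff y (Set.Ioo_subset_Ico_self hv)
  rw [dist_comm y x]
  simp only [hr, hs, lt_min_iff]
  by_cases hrd : r < dist x y / 2
  · by_cases hsd : s < dist x y / 2
    · simp only [hrd, hsd, and_true]
      exact pi_lt_minDist_inter_le (by linarith)
    · simp [hsd]
  · simp [hrd]

lemma memLp_logTruncatedProb_of_ne (h : HasLogQuadraticDensity μ f) (hxy : x ≠ y) :
    MemLp (fun z : ι → E => logTruncatedProb μ x y z) 2 (Measure.pi fun _ => μ) := by
  refine ((memLp_log_of_hasLaw_minUniformLaw (h.hasLaw_ballProb_minDist x)).add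
    (h.memLp_truncationGap_of_ne hxy)).ae_eq (Eventually.of_forall fun z => ?_)
  simp [truncationGap, logNearestProb]

lemma covariance_logTruncatedProb_nonpos (h : HasLogQuadraticDensity μ f) (hxy : x ≠ y) :
    cov[logTruncatedProb μ x y, logTruncatedProb μ y x; Measure.pi fun _ : ι => μ] ≤ 0 := by
  have hmeas : ∀ a b : E, Measurable fun z : ι → E =>
      ballProb μ a (min (minDist a z) (dist a b / 2)) := fun a b =>
    measurable_ballProb.comp (measurable_const.prodMk
      ((measurable_minDist.comp measurable_prodMk_left).min measurable_const))
  have hpos : ∀ {a b : E}, a ≠ b → ∀ᵐ z ∂(Measure.pi fun _ : ι => μ),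
      0 < ballProb μ a (min (minDist a z) (dist a b / 2)) := fun {a b} hab => by
    filter_upwards [h.ae_minDist_pos (h.hasLaw_ballProb_minDist a)] with z hz
    exact h.ballProb_pos_iff.2 (lt_min hz (half_pos (dist_pos.2 hab)))
  exact covariance_log_log_nonpos (hmeas x y) (hmeas y x) (fun _ => ballProb_le_one _ _)
    (fun _ => ballProb_le_one _ _) (hpos hxy) (hpos hxy.symm)
    (h.memLp_logTruncatedProb_of_ne hxy) (h.memLp_logTruncatedProb_of_ne hxy.symm)
    fun u hu v hv => h.pi_lt_ballProb_truncated_inter_le x y hu hv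

lemma integral_add_logTruncatedProb_mul_sub_truncationGap_sq_le (h : HasLogQuadraticDensity μ f)
    (hxy : x ≠ y) (k : ℝ) :
    ∫ z, ((k + logTruncatedProb μ x y z) * (k + logTruncatedProb μ y x z) -
        truncationGap μ x y z ^ 2 - truncationGap μ y x z ^ 2) ∂(Measure.pi fun _ : ι => μ) ≤
      2 * (k - harmonic (Fintype.card ι)) ^ 2 := by
  have hT := h.memLp_logTruncatedProb_of_ne (ι := ι) hxy
  have hT' := h.memLp_logTruncatedProb_of_ne (ι := ι) hxy.symm
  have hW := h.hasLaw_ballProb_minDist (ι := ι) x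
  have hW' := h.hasLaw_ballProb_minDist (ι := ι) y
  have hle : _ ≤ _ + ∫ z, truncationGap μ x y z ^ 2 ∂_ + ∫ z, truncationGap μ y x z ^ 2 ∂_ :=
    integral_add_mul_add_le_of_covariance_nonpos (k := k) hT hT'
      (memLp_log_of_hasLaw_minUniformLaw hW) (memLp_log_of_hasLaw_minUniformLaw hW')
      (h.covariance_logTruncatedProb_nonpos hxy) (integral_log_of_hasLaw_minUniformLaw hW)
      (integral_log_of_hasLaw_minUniformLaw hW')
  have hprod : Integrable (fun z : ι → E => (k + logTruncatedProb μ x y z) *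
      (k + logTruncatedProb μ y x z)) (Measure.pi fun _ => μ) :=
    ((memLp_const k).add hT).integrable_mul ((memLp_const k).add hT')
  have hgap := (h.memLp_truncationGap_of_ne (ι := ι) hxy).integrable_sq
  have hsub : Integrable (fun z : ι → E => (k + logTruncatedProb μ x y z) *
      (k + logTruncatedProb μ y x z) - truncationGap μ x y z ^ 2) (Measure.pi fun _ => μ) :=
    hprod.sub hgap
  rw [integral_sub hsub (h.memLp_truncationGap_of_ne hxy.symm).integrable_sq,
    integral_sub hprod hgap, sub_eq_add_neg k]
  linarith

end HasLogQuadraticDensity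

end FixedCentres

section Law

variable {A B C : Type*} [MeasurableSpace A] [MeasurableSpace B] [MeasurableSpace C]
  {Ω : Type*} [MeasurableSpace Ω] {P : Measure Ω}

lemma hasLaw_swap_of_hasLaw_prod_prod {x : Ω → A} {y : Ω → B} {z : Ω → C} {μ : Measure A}
    {ν : Measure B} {κ : Measure C} [SFinite μ] [SFinite ν] [SFinite κ]
    (hxyz : HasLaw (fun ω => (x ω, y ω, z ω)) (μ.prod (ν.prod κ)) P) :
    HasLaw (fun ω => (y ω, x ω, z ω)) (ν.prod (μ.prod κ)) P :=
  ((measurePreserving_prodAssoc ν μ κ).comp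
    ((Measure.measurePreserving_swap.prod (MeasurePreserving.id κ)).comp
      (measurePreserving_prodAssoc μ ν κ).symm)).hasLaw.comp hxyz

lemma hasLaw_fst_of_hasLaw_prod_prod {x : Ω → A} {y : Ω → B} {z : Ω → C} {μ : Measure A}
    {ν : Measure B} {κ : Measure C} [SFinite μ] [SFinite ν] [IsProbabilityMeasure κ]
    (hxyz : HasLaw (fun ω => (x ω, y ω, z ω)) (μ.prod (ν.prod κ)) P) :
    HasLaw (fun ω => (x ω, y ω)) (μ.prod ν) P :=
  ((MeasurePreserving.id μ).prod measurePreserving_fst).hasLaw.comp hxyz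

lemma hasLaw_snd_of_hasLaw_prod_prod {x : Ω → A} {y : Ω → B} {z : Ω → C} {μ : Measure A}
    {ν : Measure B} {κ : Measure C} [SFinite μ] [IsProbabilityMeasure ν] [SFinite κ]
    (hxyz : HasLaw (fun ω => (x ω, y ω, z ω)) (μ.prod (ν.prod κ)) P) :
    HasLaw (fun ω => (x ω, z ω)) (μ.prod κ) P :=
  ((MeasurePreserving.id μ).prod measurePreserving_snd).hasLaw.comp hxyz

lemma integral_prod_prod_le_of_forall_ne {μ : Measure A} {κ : Measure C}
    [IsProbabilityMeasure μ] [NullSingletonClass μ] [IsProbabilityMeasure κ] {φ : A × A × C → ℝ}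
    {c : ℝ}
    (hφ : Integrable φ (μ.prod (μ.prod κ)))
    (hc : ∀ x y, x ≠ y → ∫ z, φ (x, y, z) ∂κ ≤ c) :
    ∫ p, φ p ∂(μ.prod (μ.prod κ)) ≤ c := by
  rw [integral_prod _ hφ]
  have hx : ∀ᵐ x ∂μ, ∫ q, φ (x, q) ∂(μ.prod κ) ≤ c := by
    filter_upwards [hφ.prod_right_ae] with x hxI
    rw [integral_prod _ hxI]
    have hy : ∀ᵐ y ∂μ, ∫ z, φ (x, y, z) ∂κ ≤ c := by
      filter_upwards [compl_mem_ae_iff.2 (measure_singleton x)] with y hy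
      exact hc x y fun hxy => hy hxy.symm
    simpa using integral_mono_ae hxI.integral_prod_left (integrable_const c) hy
  simpa using integral_mono_ae hφ.integral_prod_left (integrable_const c) hx

lemma memLp_dist_sq {E : Type*} [NormedAddCommGroup E] [MeasurableSpace E] {μ : Measure E}
    [IsFiniteMeasure μ] {x y : Ω → E} (hμ : MemLp id 4 μ)
    (hxy : HasLaw (fun ω => (x ω, y ω)) (μ.prod μ) P) :
    MemLp (fun ω => dist (x ω) (y ω) ^ 2) 2 P := by
  have hdiff : MemLp (fun ω => x ω - y ω) 4 P := memLp_comp_of_hasLaw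
    ((hμ.comp_fst μ).sub (hμ.comp_snd μ)) hxy
  simpa only [dist_eq_norm] using memLp_norm_sq_of_memLp_four hdiff

end Law

section RandomPair

variable {E : Type*} [NormedAddCommGroup E] [InnerProductSpace ℝ E] [FiniteDimensional ℝ E]
  [MeasurableSpace E] [BorelSpace E] {μ : Measure E} [IsProbabilityMeasure μ]
  {f : E → ℝ} {Ω : Type*} [MeasurableSpace Ω] {P : Measure Ω} {x y : Ω → E}

namespace HasLogQuadraticDensity

lemma memLp_logBallDensity [IsProbabilityMeasure P] (h : HasLogQuadraticDensity μ f)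
    (hμ : MemLp id 4 μ) (hx : HasLaw x μ P) {r : Ω → ℝ} (hrm : AEMeasurable r P)
    (hr : ∀ᵐ ω ∂P, 0 < r ω) (hr2 : MemLp (fun ω => r ω ^ 2) 2 P) :
    MemLp (fun ω => logBallDensity μ (x ω) (r ω)) 2 P := by
  obtain ⟨K, hK⟩ := h.exists_abs_logBallDensity_le
  have hx2 := memLp_norm_sq_of_memLp_four (memLp_comp_of_hasLaw hμ hx)
  have hbound := (((memLp_const (1 : ℝ)).add hx2).add hr2).const_mul K
  have hmeas := measurable_logBallDensity (μ := μ) |>.comp_aemeasurable (hx.aemeasurable.prodMk hrm)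
  refine hbound.mono' hmeas.aestronglyMeasurable ?_
  filter_upwards [hr] with ω hω
  exact hK (x ω) (r ω) hω

variable [Nontrivial E]

lemma hasLaw_ballProb_dist (h : HasLogQuadraticDensity μ f)
    (hxy : HasLaw (fun ω => (x ω, y ω)) (μ.prod μ) P) :
    HasLaw (fun ω => ballProb μ (x ω) (dist (x ω) (y ω))) (minUniformLaw 1) P := by
  have hxz : HasLaw (fun ω => (x ω, fun _ : Unit => y ω)) (μ.prod (Measure.pi fun _ => μ)) P :=
    ((MeasurePreserving.id μ).prod (measurePreserving_funUnique μ Unit).symm).hasLaw.comp hxy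
  simpa [minDist] using h.hasLaw_ballProb_minDist_comp hxz

lemma ae_dist_pos (h : HasLogQuadraticDensity μ f)
    (hxy : HasLaw (fun ω => (x ω, y ω)) (μ.prod μ) P) : ∀ᵐ ω ∂P, 0 < dist (x ω) (y ω) := by
  filter_upwards [ae_pos_of_hasLaw_minUniformLaw (h.hasLaw_ballProb_dist hxy)] with ω hω
  exact h.ballProb_pos_iff.1 hω

lemma memLp_log_dist [IsProbabilityMeasure P] (h : HasLogQuadraticDensity μ f)
    (hμ : MemLp id 4 μ) (hxy : HasLaw (fun ω => (x ω, y ω)) (μ.prod μ) P) :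
    MemLp (fun ω => Real.log (dist (x ω) (y ω))) 2 P := by
  have hpos := h.ae_dist_pos hxy
  have hmeas : AEMeasurable (fun ω => dist (x ω) (y ω)) P :=
    (measurable_fst.dist measurable_snd).comp_aemeasurable hxy.aemeasurable
  have hvol : MemLp (fun ω => Real.log (ballProb volume (x ω) (dist (x ω) (y ω)))) 2 P := by
    refine ((memLp_log_of_hasLaw_minUniformLaw (h.hasLaw_ballProb_dist hxy)).sub
      (h.memLp_logBallDensity hμ (measurePreserving_fst.hasLaw.comp hxy) hmeas hpos
        (memLp_dist_sq hμ hxy))).ae_eq (Eventually.of_forall fun ω => ?_)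
    simp [logBallDensity]
  refine ((hvol.sub (memLp_const (Real.log (ballProb volume (0 : E) 1)))).const_mul
    (Module.finrank ℝ E : ℝ)⁻¹).ae_eq ?_
  filter_upwards [hpos] with ω hω
  have hd : (Module.finrank ℝ E : ℝ) ≠ 0 := Nat.cast_ne_zero.2 Module.finrank_pos.ne'
  simp only [Pi.sub_apply, log_ballProb_volume (x ω) hω]
  field_simp
  ring

lemma memLp_log_ballProb_half_dist [IsProbabilityMeasure P] (h : HasLogQuadraticDensity μ f)
    (hμ : MemLp id 4 μ) (hxy : HasLaw (fun ω => (x ω, y ω)) (μ.prod μ) P) :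
    MemLp (fun ω => Real.log (ballProb μ (x ω) (dist (x ω) (y ω) / 2))) 2 P := by
  have hpos := h.ae_dist_pos hxy
  have hmeas : AEMeasurable (fun ω => dist (x ω) (y ω) / 2) P :=
    ((measurable_fst.dist measurable_snd).div_const 2).comp_aemeasurable hxy.aemeasurable
  have hsq : MemLp (fun ω => (dist (x ω) (y ω) / 2) ^ 2) 2 P := by
    simpa only [div_pow, div_eq_inv_mul _ (2 ^ 2 : ℝ)] using
      (memLp_dist_sq hμ hxy).const_mul (2 ^ 2 : ℝ)⁻¹
  have hdensity := h.memLp_logBallDensity hμ (measurePreserving_fst.hasLaw.comp hxy) hmeas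
    (hpos.mono fun _ => half_pos) hsq
  have hvol : MemLp (fun ω => Module.finrank ℝ E * (Real.log (dist (x ω) (y ω)) - Real.log 2) +
      Real.log (ballProb volume (0 : E) 1)) 2 P :=
    (((h.memLp_log_dist hμ hxy).sub (memLp_const _)).const_mul _).add (memLp_const _)
  refine (hdensity.add hvol).ae_eq ?_
  filter_upwards [hpos] with ω hω
  simp [logBallDensity, log_ballProb_volume (x ω) (half_pos hω), Real.log_div hω.ne']

end HasLogQuadraticDensity

end RandomPair

section RandomCentres

variable {E : Type*} [NormedAddCommGroup E] [InnerProductSpace ℝ E] [FiniteDimensional ℝ E]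
  [MeasurableSpace E] [BorelSpace E] [Nontrivial E] {μ : Measure E} [IsProbabilityMeasure μ]
  {f : E → ℝ} {ι : Type*} [Fintype ι] {Ω : Type*} [MeasurableSpace Ω] {P : Measure Ω}
  [IsProbabilityMeasure P] {x y : Ω → E} {z : Ω → ι → E}

namespace HasLogQuadraticDensity

lemma memLp_truncationGap (h : HasLogQuadraticDensity μ f) (hμ : MemLp id 4 μ)
    (hxyz : HasLaw (fun ω => (x ω, y ω, z ω)) (μ.prod (μ.prod (Measure.pi fun _ => μ))) P) :
    MemLp (fun ω => truncationGap μ (x ω) (y ω) (z ω)) 2 P := by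
  have hxy := hasLaw_fst_of_hasLaw_prod_prod hxyz
  refine (h.memLp_log_ballProb_half_dist hμ hxy).abs.mono'
    (measurable_truncationGap.comp_aemeasurable hxyz.aemeasurable).aestronglyMeasurable ?_
  filter_upwards [h.ae_dist_pos hxy] with ω hω
  exact h.abs_truncationGap_le (dist_pos.1 hω)

lemma exists_memLp_abs_log_volume_add_log_sub_le (h : HasLogQuadraticDensity μ f)
    (hμ : MemLp id 4 μ) (hxy : HasLaw (fun ω => (x ω, y ω)) (μ.prod μ) P) :
    ∃ G : Ω → ℝ, MemLp G 2 P ∧ ∀ᵐ ω ∂P, ∀ r, 0 < r →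
      |Real.log (ballProb volume (x ω) (min r (dist (x ω) (y ω)))) + Real.log (f (x ω)) -
        Real.log (ballProb μ (x ω) (min r (dist (x ω) (y ω) / 2)))| ≤ G ω := by
  obtain ⟨C, hC⟩ := h.exists_abs_log_volume_add_log_sub_le
  have hx2 := memLp_norm_sq_of_memLp_four
    (memLp_comp_of_hasLaw hμ (measurePreserving_fst.hasLaw.comp hxy))
  refine ⟨_, ((((memLp_const (1 : ℝ)).add hx2).add (memLp_dist_sq hμ hxy)).const_mul C).add
    (h.memLp_log_ballProb_half_dist hμ hxy).abs, ?_⟩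
  filter_upwards [h.ae_dist_pos hxy] with ω hω r hr
  exact hC (x ω) r _ hr hω

variable [Nonempty ι]

lemma memLp_logTruncatedProb (h : HasLogQuadraticDensity μ f) (hμ : MemLp id 4 μ)
    (hxyz : HasLaw (fun ω => (x ω, y ω, z ω)) (μ.prod (μ.prod (Measure.pi fun _ => μ))) P) :
    MemLp (fun ω => logTruncatedProb μ (x ω) (y ω) (z ω)) 2 P := by
  have hW := h.hasLaw_ballProb_minDist_comp (hasLaw_snd_of_hasLaw_prod_prod hxyz)
  refine ((memLp_log_of_hasLaw_minUniformLaw hW).add (h.memLp_truncationGap hμ hxyz)).ae_eq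
    (Eventually.of_forall fun ω => ?_)
  simp [truncationGap, logNearestProb]

lemma memLp_truncationError (h : HasLogQuadraticDensity μ f) (hμ : MemLp id 4 μ)
    (hxyz : HasLaw (fun ω => (x ω, y ω, z ω)) (μ.prod (μ.prod (Measure.pi fun _ => μ))) P) :
    MemLp (fun ω => truncationError μ f (x ω) (y ω) (z ω)) 2 P := by
  obtain ⟨G, hG, hle⟩ := h.exists_memLp_abs_log_volume_add_log_sub_le hμ
    (hasLaw_fst_of_hasLaw_prod_prod hxyz)
  have hmeas := (measurable_truncationError (μ := μ) (ι := ι)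
    h.continuous_log.measurable).comp_aemeasurable hxyz.aemeasurable
  refine hG.mono' hmeas.aestronglyMeasurable ?_
  filter_upwards [hle, h.ae_minDist_pos (h.hasLaw_ballProb_minDist_comp
    (hasLaw_snd_of_hasLaw_prod_prod hxyz))] with ω hω hpos
  exact hω _ hpos

end HasLogQuadraticDensity

end RandomCentres

section PairError

variable {E : Type*} [NormedAddCommGroup E] [InnerProductSpace ℝ E] [FiniteDimensional ℝ E]
  [MeasurableSpace E] [BorelSpace E] {μ : Measure E} [IsProbabilityMeasure μ]
  {f : E → ℝ} {ι : Type*} [Fintype ι] {Ω : Type*} [MeasurableSpace Ω] {P : Measure Ω}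
  {x y : Ω → E} {z : Ω → ι → E}

/-- The error of the nearest-neighbour estimate `-log (vol B) - log (card ι + 1) - γ` of
`log (f x)`, where `B` is the ball around `x` that reaches to the nearest among `y` and the
family `z`. -/
noncomputable def pairError (f : E → ℝ) (x y : E) (z : ι → E) : ℝ :=
  Real.eulerMascheroniConstant + Real.log (Fintype.card ι + 1) +
    Real.log (ballProb volume x (min (minDist x z) (dist x y))) + Real.log (f x)

lemma pairError_eq_add_truncationError (μ : Measure E) (f : E → ℝ) (x y : E) (z : ι → E) :
    pairError f x y z = Real.eulerMascheroniConstant + Real.log (Fintype.card ι + 1) +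
      logTruncatedProb μ x y z + truncationError μ f x y z := by
  rw [pairError, truncationError]
  ring

variable [Nontrivial E] [Nonempty ι]

namespace HasLogQuadraticDensity

lemma integral_prod_add_logTruncatedProb_mul_le (h : HasLogQuadraticDensity μ f)
    (hμ : MemLp id 4 μ) (k : ℝ) :
    ∫ p : E × E × (ι → E), (k + logTruncatedProb μ p.1 p.2.1 p.2.2) *
        (k + logTruncatedProb μ p.2.1 p.1 p.2.2) ∂(μ.prod (μ.prod (Measure.pi fun _ => μ))) ≤
      2 * (k - harmonic (Fintype.card ι)) ^ 2 +
        2 * ∫ p : E × E × (ι → E), truncationGap μ p.1 p.2.1 p.2.2 ^ 2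
          ∂(μ.prod (μ.prod (Measure.pi fun _ => μ))) := by
  have := h.nullSingletonClass
  have hid := HasLaw.id (μ := μ.prod (μ.prod (Measure.pi fun _ : ι => μ)))
  have hswap := hasLaw_swap_of_hasLaw_prod_prod hid
  set Q := μ.prod (μ.prod (Measure.pi fun _ : ι => μ))
  have hT := (memLp_const (μ := Q) k).add (h.memLp_logTruncatedProb hμ hid)
  have hT' := (memLp_const (μ := Q) k).add (h.memLp_logTruncatedProb hμ hswap)
  have hprod : Integrable (fun p : E × E × (ι → E) => (k + logTruncatedProb μ p.1 p.2.1 p.2.2) *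
      (k + logTruncatedProb μ p.2.1 p.1 p.2.2)) Q := hT.integrable_mul hT'
  have hgap := (h.memLp_truncationGap hμ hid).integrable_sq
  have hgap' := (h.memLp_truncationGap hμ hswap).integrable_sq
  have hsymm : ∫ p : E × E × (ι → E), truncationGap μ p.2.1 p.1 p.2.2 ^ 2 ∂Q =
      ∫ p : E × E × (ι → E), truncationGap μ p.1 p.2.1 p.2.2 ^ 2 ∂Q :=
    hswap.integral_comp (measurable_truncationGap.pow_const 2).aestronglyMeasurable
  have hle := integral_prod_prod_le_of_forall_ne ((hprod.sub hgap).sub hgap')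
    fun a b hab => h.integral_add_logTruncatedProb_mul_sub_truncationGap_sq_le hab k
  rw [integral_sub' (hprod.sub hgap) hgap', integral_sub' hprod hgap] at hle
  rw [hsymm] at hle
  linarith

lemma integral_add_logTruncatedProb_mul_le (h : HasLogQuadraticDensity μ f) (hμ : MemLp id 4 μ)
    (hxyz : HasLaw (fun ω => (x ω, y ω, z ω)) (μ.prod (μ.prod (Measure.pi fun _ => μ))) P)
    (k : ℝ) :
    ∫ ω, (k + logTruncatedProb μ (x ω) (y ω) (z ω)) *
        (k + logTruncatedProb μ (y ω) (x ω) (z ω)) ∂P ≤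
      2 * (k - harmonic (Fintype.card ι)) ^ 2 +
        2 * ∫ ω, truncationGap μ (x ω) (y ω) (z ω) ^ 2 ∂P := by
  have hp : Measurable fun p : E × E × (ι → E) => (p.2.1, p.1, p.2.2) := by fun_prop
  have hT := (measurable_logTruncatedProb (μ := μ) (ι := ι)).const_add k
  have hprod := hT.mul (hT.comp hp) |>.aestronglyMeasurable
    (μ := μ.prod (μ.prod (Measure.pi fun _ : ι => μ)))
  have hgap := (measurable_truncationGap (μ := μ) (ι := ι)).pow_const 2 |>.aestronglyMeasurable
    (μ := μ.prod (μ.prod (Measure.pi fun _ : ι => μ)))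
  have hle := h.integral_prod_add_logTruncatedProb_mul_le (ι := ι) hμ k
  rw [← hxyz.integral_comp hgap] at hle
  exact (hxyz.integral_comp hprod).trans_le hle

variable [IsProbabilityMeasure P]

lemma integral_add_logTruncatedProb_sq_le (h : HasLogQuadraticDensity μ f) (hμ : MemLp id 4 μ)
    (hxyz : HasLaw (fun ω => (x ω, y ω, z ω)) (μ.prod (μ.prod (Measure.pi fun _ => μ))) P)
    (c : ℝ) :
    ∫ ω, (c + Real.log (Fintype.card ι + 1) + logTruncatedProb μ (x ω) (y ω) (z ω)) ^ 2 ∂P ≤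
      4 * c ^ 2 + 144 + 2 * ∫ ω, truncationGap μ (x ω) (y ω) (z ω) ^ 2 ∂P := by
  have hW := h.hasLaw_ballProb_minDist_comp (hasLaw_snd_of_hasLaw_prod_prod hxyz)
  have hlog := (memLp_const (μ := P) (Real.log (Fintype.card ι + 1))).add
    (memLp_log_of_hasLaw_minUniformLaw hW)
  have hclog := (memLp_const (μ := P) c).add hlog
  calc ∫ ω, (c + Real.log (Fintype.card ι + 1) + logTruncatedProb μ (x ω) (y ω) (z ω)) ^ 2 ∂P
      = ∫ ω, (c + (Real.log (Fintype.card ι + 1) + logNearestProb μ (x ω) (z ω)) +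
          truncationGap μ (x ω) (y ω) (z ω)) ^ 2 ∂P := by
        congr 1 with ω
        rw [truncationGap]
        ring
    _ ≤ 2 * ∫ ω, (c + (Real.log (Fintype.card ι + 1) + logNearestProb μ (x ω) (z ω))) ^ 2 ∂P +
          2 * ∫ ω, truncationGap μ (x ω) (y ω) (z ω) ^ 2 ∂P :=
        integral_add_sq_le hclog (h.memLp_truncationGap hμ hxyz)
    _ ≤ 2 * (2 * ∫ _, c ^ 2 ∂P +
          2 * ∫ ω, (Real.log (Fintype.card ι + 1) + logNearestProb μ (x ω) (z ω)) ^ 2 ∂P) +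
          2 * ∫ ω, truncationGap μ (x ω) (y ω) (z ω) ^ 2 ∂P := by
        gcongr
        exact integral_add_sq_le (memLp_const c) hlog
    _ ≤ 2 * (2 * c ^ 2 + 2 * 36) + 2 * ∫ ω, truncationGap μ (x ω) (y ω) (z ω) ^ 2 ∂P := by
        gcongr
        · simp
        · exact integral_log_add_log_sq_le_of_hasLaw_minUniformLaw Fintype.card_ne_zero hW
    _ = _ := by ring

lemma memLp_const_add_logTruncatedProb (h : HasLogQuadraticDensity μ f) (hμ : MemLp id 4 μ)
    (hxyz : HasLaw (fun ω => (x ω, y ω, z ω)) (μ.prod (μ.prod (Measure.pi fun _ => μ))) P)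
    (c : ℝ) : MemLp (fun ω => c + logTruncatedProb μ (x ω) (y ω) (z ω)) 2 P :=
  (memLp_const c).add (h.memLp_logTruncatedProb hμ hxyz)

lemma integral_pairError_sq_le (h : HasLogQuadraticDensity μ f) (hμ : MemLp id 4 μ)
    (hxyz : HasLaw (fun ω => (x ω, y ω, z ω)) (μ.prod (μ.prod (Measure.pi fun _ => μ))) P) :
    ∫ ω, pairError f (x ω) (y ω) (z ω) ^ 2 ∂P ≤
      2 * (4 * Real.eulerMascheroniConstant ^ 2 + 144 +
        2 * ∫ ω, truncationGap μ (x ω) (y ω) (z ω) ^ 2 ∂P) +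
        2 * ∫ ω, truncationError μ f (x ω) (y ω) (z ω) ^ 2 ∂P := by
  simp only [pairError_eq_add_truncationError μ]
  refine (integral_add_sq_le (h.memLp_const_add_logTruncatedProb hμ hxyz _)
    (h.memLp_truncationError hμ hxyz)).trans ?_
  gcongr
  exact h.integral_add_logTruncatedProb_sq_le hμ hxyz _

lemma integral_pairError_mul_le (h : HasLogQuadraticDensity μ f) (hμ : MemLp id 4 μ)
    (hxyz : HasLaw (fun ω => (x ω, y ω, z ω)) (μ.prod (μ.prod (Measure.pi fun _ => μ))) P) :
    ∫ ω, pairError f (x ω) (y ω) (z ω) * pairError f (y ω) (x ω) (z ω) ∂P ≤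
      2 * (Real.eulerMascheroniConstant + Real.log (Fintype.card ι + 1) -
        harmonic (Fintype.card ι)) ^ 2 +
        2 * ∫ ω, truncationGap μ (x ω) (y ω) (z ω) ^ 2 ∂P +
        2 * (√(4 * Real.eulerMascheroniConstant ^ 2 + 144 +
          2 * ∫ ω, truncationGap μ (x ω) (y ω) (z ω) ^ 2 ∂P) *
            √(∫ ω, truncationError μ f (x ω) (y ω) (z ω) ^ 2 ∂P)) +
        ∫ ω, truncationError μ f (x ω) (y ω) (z ω) ^ 2 ∂P := by
  have hyxz := hasLaw_swap_of_hasLaw_prod_prod hxyz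
  have hE := (measurable_truncationError (μ := μ) (ι := ι) h.continuous_log.measurable).pow_const 2
    |>.aestronglyMeasurable (μ := μ.prod (μ.prod (Measure.pi fun _ => μ)))
  have hG := (measurable_truncationGap (μ := μ) (ι := ι)).pow_const 2
    |>.aestronglyMeasurable (μ := μ.prod (μ.prod (Measure.pi fun _ => μ)))
  have herr : ∫ ω, truncationError μ f (y ω) (x ω) (z ω) ^ 2 ∂P =
      ∫ ω, truncationError μ f (x ω) (y ω) (z ω) ^ 2 ∂P :=
    (hyxz.integral_comp hE).trans (hxyz.integral_comp hE).symm
  have hgap : ∫ ω, truncationGap μ (y ω) (x ω) (z ω) ^ 2 ∂P =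
      ∫ ω, truncationGap μ (x ω) (y ω) (z ω) ^ 2 ∂P :=
    (hyxz.integral_comp hG).trans (hxyz.integral_comp hG).symm
  have hsq := h.integral_add_logTruncatedProb_sq_le hμ hxyz Real.eulerMascheroniConstant
  have hsq' := h.integral_add_logTruncatedProb_sq_le hμ hyxz Real.eulerMascheroniConstant
  rw [hgap] at hsq'
  simp only [pairError_eq_add_truncationError μ]
  refine (integral_add_mul_add_le (h.memLp_const_add_logTruncatedProb hμ hxyz _)
    (h.memLp_const_add_logTruncatedProb hμ hyxz _) (h.memLp_truncationError hμ hxyz)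
    (h.memLp_truncationError hμ hyxz)).trans ?_
  rw [herr, Real.mul_self_sqrt (integral_nonneg fun _ => sq_nonneg _),
    mul_comm (√(∫ ω, truncationError μ f (x ω) (y ω) (z ω) ^ 2 ∂P)), two_mul (_ * _), ← add_assoc]
  gcongr
  exact h.integral_add_logTruncatedProb_mul_le hμ hxyz _

end HasLogQuadraticDensity

end PairError

section Sample

lemma exists_perm_apply {α : Type*} {a b i j : α} (hab : a ≠ b) (hij : i ≠ j) :
    ∃ σ : Equiv.Perm α, σ a = i ∧ σ b = j := by
  classical
  refine ⟨(Equiv.swap a i).trans (Equiv.swap (Equiv.swap a i b) j), ?_, by simp⟩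
  have hi : Equiv.swap a i b ≠ i := fun hb => hab <| by
    rwa [Equiv.swap_apply_eq_iff, Equiv.swap_apply_right, eq_comm] at hb
  simp [Equiv.swap_apply_of_ne_of_ne hi.symm hij]

lemma exists_injective_apply_zero_apply_one {i j : ℕ} (hij : i ≠ j) :
    ∃ σ : ℕ → ℕ, σ.Injective ∧ σ 0 = i ∧ σ 1 = j := by
  obtain ⟨σ, hi, hj⟩ := exists_perm_apply zero_ne_one hij
  exact ⟨σ, σ.injective, hi, hj⟩

variable {Ω E : Type*} [MeasurableSpace Ω] [MeasurableSpace E] {P : Measure Ω} {μ : Measure E}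
  {X : ℕ → Ω → E}

/-- `X` is a sequence of independent random variables with common law `μ`. -/
structure IsIIDSequence (P : Measure Ω) (μ : Measure E) (X : ℕ → Ω → E) : Prop where
  hasLaw : ∀ i, HasLaw (X i) μ P
  iIndepFun : iIndepFun X P

/-- The `n + 1` sample points that follow the first two; together with these they form a sample of
size `n + 3`. -/
def tailPoints (X : ℕ → Ω → E) (n : ℕ) (ω : Ω) : Fin (n + 1) → E := fun j => X (j + 2) ω

namespace IsIIDSequence

lemma comp_injective (hX : IsIIDSequence P μ X) {σ : ℕ → ℕ} (hσ : σ.Injective) :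
    IsIIDSequence P μ (X ∘ σ) :=
  ⟨fun _ => hX.hasLaw _, hX.iIndepFun.precomp (g := σ) hσ⟩

lemma hasLaw_fin (hX : IsIIDSequence P μ X) (n : ℕ) :
    HasLaw (fun ω (i : Fin n) => X i ω) (Measure.pi fun _ => μ) P :=
  (hX.iIndepFun.precomp Fin.val_injective).hasLaw_pi fun _ => hX.hasLaw _

variable [IsProbabilityMeasure μ]

lemma isProbabilityMeasure (hX : IsIIDSequence P μ X) : IsProbabilityMeasure P :=
  (hX.hasLaw 0).isProbabilityMeasure

lemma hasLaw_head_tail (hX : IsIIDSequence P μ X) (n : ℕ) :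
    HasLaw (fun ω => (X 0 ω, fun j : Fin n => X (j + 1) ω)) (μ.prod (Measure.pi fun _ => μ)) P :=
  (measurePreserving_piFinSuccAbove (fun _ : Fin (n + 1) => μ) 0).hasLaw.comp
    (hX.hasLaw_fin (n + 1))

lemma hasLaw_tailPoints (hX : IsIIDSequence P μ X) (n : ℕ) :
    HasLaw (fun ω => (X 0 ω, X 1 ω, tailPoints X n ω)) (μ.prod (μ.prod (Measure.pi fun _ => μ)))
      P :=
  ((MeasurePreserving.id μ).prod
    (measurePreserving_piFinSuccAbove (fun _ : Fin (n + 2) => μ) 0)).hasLaw.comp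
    (hX.hasLaw_head_tail (n + 2))

lemma hasLaw_pair (hX : IsIIDSequence P μ X) {i j : ℕ} (hij : i ≠ j) :
    HasLaw (fun ω => (X i ω, X j ω)) (μ.prod μ) P := by
  obtain ⟨σ, hσ, rfl, rfl⟩ := exists_injective_apply_zero_apply_one hij
  exact hasLaw_fst_of_hasLaw_prod_prod ((hX.comp_injective hσ).hasLaw_tailPoints 0)

end IsIIDSequence

end Sample

section Asymptotics

lemma antitone_minDist_tailPoints {E Ω : Type*} [PseudoMetricSpace E] (X : ℕ → Ω → E) (ω : Ω) :
    Antitone fun n => minDist (X 0 ω) (tailPoints X n ω) := fun m n hmn => by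
  obtain ⟨j, hj⟩ := exists_dist_eq_minDist (X 0 ω) (tailPoints X m ω)
  exact (minDist_le (X 0 ω) (tailPoints X n ω) ⟨j, by omega⟩).trans_eq hj

variable {E : Type*} [NormedAddCommGroup E] [InnerProductSpace ℝ E] [FiniteDimensional ℝ E]
  [MeasurableSpace E] [BorelSpace E] {μ : Measure E} {f : E → ℝ} {Ω : Type*} [MeasurableSpace Ω]
  {P : Measure Ω} {X : ℕ → Ω → E}

namespace IsIIDSequence

variable [Nontrivial E] [IsProbabilityMeasure μ]

lemma hasLaw_ballProb_minDist_tailPoints (hX : IsIIDSequence P μ X)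
    (h : HasLogQuadraticDensity μ f) (n : ℕ) :
    HasLaw (fun ω => ballProb μ (X 0 ω) (minDist (X 0 ω) (tailPoints X n ω)))
      (minUniformLaw (n + 1)) P := by
  simpa using h.hasLaw_ballProb_minDist_comp
    (hasLaw_snd_of_hasLaw_prod_prod (hX.hasLaw_tailPoints n))

lemma ae_tendsto_ballProb_minDist (hX : IsIIDSequence P μ X) (h : HasLogQuadraticDensity μ f) :
    ∀ᵐ ω ∂P, Tendsto (fun n => ballProb μ (X 0 ω) (minDist (X 0 ω) (tailPoints X n ω)))
      atTop (𝓝 0) := by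
  have := hX.isProbabilityMeasure
  have hW := hX.hasLaw_ballProb_minDist_tailPoints h
  have hint : ∀ n, ∫ ω, ballProb μ (X 0 ω) (minDist (X 0 ω) (tailPoints X n ω)) ∂P =
      1 / (((n + 1 : ℕ) : ℝ) + 1) := fun n =>
    ((hW n).integral_comp aestronglyMeasurable_id).trans (integral_id_minUniformLaw n.succ_ne_zero)
  refine tendsto_of_integral_tendsto_of_antitone (F := fun _ => 0) (fun n => ?_)
    (integrable_zero _ _ _) ?_ ?_ ?_
  · exact Integrable.of_bound (hW n).aemeasurable.aestronglyMeasurable 1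
      (Eventually.of_forall fun ω => by
        rw [Real.norm_of_nonneg (ballProb_nonneg _ _)]
        exact ballProb_le_one _ _)
  · simp only [hint, integral_zero]
    exact (tendsto_add_atTop_iff_nat 1).2 tendsto_one_div_add_atTop_nhds_zero_nat
  · exact Eventually.of_forall fun ω =>
      (monotone_ballProb (X 0 ω)).comp_antitone (antitone_minDist_tailPoints X ω)
  · exact Eventually.of_forall fun ω n => ballProb_nonneg _ _

lemma ae_tendsto_minDist (hX : IsIIDSequence P μ X) (h : HasLogQuadraticDensity μ f) :
    ∀ᵐ ω ∂P, Tendsto (fun n => minDist (X 0 ω) (tailPoints X n ω)) atTop (𝓝[>] 0) := by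
  filter_upwards [hX.ae_tendsto_ballProb_minDist h, ae_all_iff.2 fun n =>
    h.ae_minDist_pos (hX.hasLaw_ballProb_minDist_tailPoints h n)] with ω hlim hpos
  refine tendsto_nhdsWithin_iff.2 ⟨?_, Eventually.of_forall hpos⟩
  refine tendsto_order.2 ⟨fun a ha => Eventually.of_forall fun n => ha.trans (hpos n),
    fun ε hε => ?_⟩
  filter_upwards [hlim.eventually_lt_const (h.ballProb_pos_iff.2 hε)] with n hn
  exact (monotone_ballProb (X 0 ω)).reflect_lt hn

lemma ae_eventually_minDist_lt (hX : IsIIDSequence P μ X) (h : HasLogQuadraticDensity μ f) :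
    ∀ᵐ ω ∂P, ∀ᶠ n in atTop, minDist (X 0 ω) (tailPoints X n ω) < dist (X 0 ω) (X 1 ω) / 2 := by
  filter_upwards [h.ae_dist_pos (hX.hasLaw_pair zero_ne_one), hX.ae_tendsto_minDist h]
    with ω hpos hlim
  exact (hlim.mono_right nhdsWithin_le_nhds).eventually_lt_const (half_pos hpos)

lemma tendsto_integral_truncationGap_sq (hX : IsIIDSequence P μ X)
    (h : HasLogQuadraticDensity μ f) (hμ : MemLp id 4 μ) :
    Tendsto (fun n => ∫ ω, truncationGap μ (X 0 ω) (X 1 ω) (tailPoints X n ω) ^ 2 ∂P)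
      atTop (𝓝 0) := by
  have := hX.isProbabilityMeasure
  have hxy := hX.hasLaw_pair zero_ne_one
  refine tendsto_integral_sq_of_dominated (h.memLp_log_ballProb_half_dist hμ hxy).abs
    (fun n => (h.memLp_truncationGap hμ (hX.hasLaw_tailPoints n)).aestronglyMeasurable)
    (fun n => ?_) ?_
  · filter_upwards [h.ae_dist_pos hxy] with ω hω
    exact h.abs_truncationGap_le (dist_pos.1 hω)
  · filter_upwards [hX.ae_eventually_minDist_lt h] with ω hω
    refine tendsto_const_nhds.congr' ?_
    filter_upwards [hω] with n hn
    rw [truncationGap, logTruncatedProb, logNearestProb, min_eq_left hn.le, sub_self]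

lemma tendsto_integral_truncationError_sq (hX : IsIIDSequence P μ X)
    (h : HasLogQuadraticDensity μ f) (hμ : MemLp id 4 μ) :
    Tendsto (fun n => ∫ ω, truncationError μ f (X 0 ω) (X 1 ω) (tailPoints X n ω) ^ 2 ∂P)
      atTop (𝓝 0) := by
  have := hX.isProbabilityMeasure
  obtain ⟨G, hG, hle⟩ :=
    h.exists_memLp_abs_log_volume_add_log_sub_le hμ (hX.hasLaw_pair zero_ne_one)
  refine tendsto_integral_sq_of_dominated hG
    (fun n => (h.memLp_truncationError hμ (hX.hasLaw_tailPoints n)).aestronglyMeasurable)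
    (fun n => ?_) ?_
  · filter_upwards [hle, h.ae_minDist_pos (hX.hasLaw_ballProb_minDist_tailPoints h n)]
      with ω hω hpos
    exact hω _ hpos
  · filter_upwards [hX.ae_eventually_minDist_lt h, hX.ae_tendsto_minDist h] with ω hω hlim
    have hdensity := ((h.tendsto_logBallDensity (X 0 ω)).comp hlim).const_sub
      (Real.log (f (X 0 ω)))
    rw [sub_self] at hdensity
    refine hdensity.congr' ?_
    filter_upwards [hω] with n hn
    have hn' := hn.le.trans (half_le_self dist_nonneg)
    rw [truncationError, logTruncatedProb, min_eq_left hn.le, min_eq_left hn',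
      Function.comp_apply, logBallDensity]
    ring

end IsIIDSequence

end Asymptotics

section LawOfLargeNumbers

variable {Ω E : Type*} [MeasurableSpace Ω] [MeasurableSpace E] {P : Measure Ω} {μ : Measure E}
  {X : ℕ → Ω → E} {g : E → ℝ}

namespace IsIIDSequence

lemma memLp_mean_comp (hX : IsIIDSequence P μ X) (hg : MemLp g 2 μ) (N : ℕ) :
    MemLp (fun ω => (1 : ℝ) / N * ∑ i : Fin N, g (X i ω)) 2 P := by
  have hcomp (i : Fin N) : MemLp (fun ω => g (X i ω)) 2 P := memLp_comp_of_hasLaw hg (hX.hasLaw i)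
  have hsum : MemLp (fun ω => ∑ i : Fin N, g (X i ω)) 2 P :=
    memLp_finsetSum _ fun i _ => hcomp i
  exact hsum.const_mul _

variable [IsProbabilityMeasure μ]

lemma integral_mean_comp_sq_le (hX : IsIIDSequence P μ X) (hg : MemLp g 2 μ)
    (hg0 : ∫ x, g x ∂μ = 0) {N : ℕ} (hN : N ≠ 0) :
    ∫ ω, ((1 : ℝ) / N * ∑ i : Fin N, g (X i ω)) ^ 2 ∂P ≤ (∫ x, g x * g x ∂μ) / N := by
  have hdiag (i : Fin N) : ∫ ω, g (X i ω) * g (X i ω) ∂P ≤ ∫ x, g x * g x ∂μ :=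
    ((hX.hasLaw i).integral_comp (hg.1.mul hg.1)).le
  have hoff (i j : Fin N) (hij : i ≠ j) : ∫ ω, g (X i ω) * g (X j ω) ∂P ≤ 0 := by
    have hpair := (hX.hasLaw_pair (Fin.val_ne_of_ne hij)).integral_comp
      (hg.1.comp_fst.mul hg.1.comp_snd)
    refine (hpair.trans ?_).le
    exact (integral_prod_mul g g).trans (by rw [hg0, zero_mul])
  simpa using integral_mean_sq_le hN (fun i : Fin N => memLp_comp_of_hasLaw hg (hX.hasLaw i))
    hdiag hoff le_rfl

lemma tendsto_integral_mean_comp_sub_sq (hX : IsIIDSequence P μ X) (hg : MemLp g 2 μ) :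
    Tendsto (fun N : ℕ => ∫ ω, ((1 : ℝ) / N * ∑ i : Fin N, g (X i ω) - ∫ x, g x ∂μ) ^ 2 ∂P)
      atTop (𝓝 0) := by
  have hsub : MemLp (fun x => g x - ∫ x, g x ∂μ) 2 μ := hg.sub (memLp_const _)
  have hmean : ∫ x, (g x - ∫ x, g x ∂μ) ∂μ = 0 := by
    rw [integral_sub (hg.integrable one_le_two) (integrable_const _)]
    simp
  refine squeeze_zero' (Eventually.of_forall fun N => integral_nonneg fun ω => sq_nonneg _) ?_
    (tendsto_const_div_atTop_nhds_zero_nat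
      (∫ x, (g x - ∫ x, g x ∂μ) * (g x - ∫ x, g x ∂μ) ∂μ))
  filter_upwards [eventually_ne_atTop 0] with N hN
  have hcenter (ω : Ω) : (1 : ℝ) / N * ∑ i : Fin N, g (X i ω) - ∫ x, g x ∂μ =
      (1 : ℝ) / N * ∑ i : Fin N, (g (X i ω) - ∫ x, g x ∂μ) := by
    rw [Finset.sum_sub_distrib, Finset.sum_const, Finset.card_univ, Fintype.card_fin, nsmul_eq_mul]
    field_simp
  simp only [hcenter]
  exact hX.integral_mean_comp_sq_le hsub hmean hN

end IsIIDSequence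

end LawOfLargeNumbers

section Sampling

variable {E : Type*}

/-- The points of a sample other than the `i`-th one. -/
def otherPoints {N : ℕ} (x : Fin N → E) (i : Fin N) : {j : Fin N // j ≠ i} → E := fun j => x j

lemma nonempty_ne {N : ℕ} (hN : 2 ≤ N) (i : Fin N) : Nonempty {j : Fin N // j ≠ i} :=
  have := Fin.nontrivial_iff_two_le.2 hN
  nonempty_subtype.2 (exists_ne i)

lemma forall_fin_ne_zero_iff {n : ℕ} {p : Fin (n + 3) → Prop} :
    (∀ j : {j : Fin (n + 3) // j ≠ 0}, p j) ↔ (∀ j : Fin (n + 1), p j.succ.succ) ∧ p 1 := by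
  rw [Subtype.forall, Fin.forall_fin_succ, Fin.forall_fin_succ]
  simp [Fin.succ_ne_zero, and_comm]

lemma minDist_otherPoints_comp_perm [PseudoMetricSpace E] {N : ℕ} (x : Fin N → E)
    (σ : Equiv.Perm (Fin N)) (i : Fin N) :
    minDist (x (σ i)) (otherPoints (x ∘ σ) i) = minDist (x (σ i)) (otherPoints x (σ i)) :=
  Equiv.iInf_congr (σ.subtypeEquiv fun j => by simp) fun _ => rfl

lemma norm_log_minDist_le_sum [PseudoMetricSpace E] {ι : Type*} [Fintype ι] [Nonempty ι] (x : E)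
    (z : ι → E) : ‖Real.log (minDist x z)‖ ≤ ∑ j, ‖Real.log (dist x (z j))‖ := by
  obtain ⟨j, hj⟩ := exists_dist_eq_minDist x z
  rw [← hj]
  exact Finset.single_le_sum (f := fun j => ‖Real.log (dist x (z j))‖)
    (fun _ _ => norm_nonneg _) (Finset.mem_univ j)

lemma minDist_otherPoints_zero [PseudoMetricSpace E] {n : ℕ} (x : Fin (n + 3) → E) :
    minDist (x 0) (otherPoints x 0) =
      min (minDist (x 0) fun j : Fin (n + 1) => x j.succ.succ) (dist (x 0) (x 1)) := by
  have := nonempty_ne (Nat.le_add_left 2 (n + 1)) 0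
  refine eq_of_forall_lt_iff fun r => ?_
  rw [lt_min_iff, lt_minDist_iff, lt_minDist_iff]
  exact forall_fin_ne_zero_iff (p := fun j => r < dist (x 0) (x j))

variable [NormedAddCommGroup E] [InnerProductSpace ℝ E] [FiniteDimensional ℝ E]
  [MeasurableSpace E] [BorelSpace E]

/-- The error, at the `i`-th point of a sample, of the nearest-neighbour estimate of the
log-density. The Kozachenko-Leonenko estimate is the mean over the sample of these errors minus the
mean of the values of `log f`. -/
noncomputable def sampleError (f : E → ℝ) {N : ℕ} (x : Fin N → E) (i : Fin N) : ℝ :=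
  Real.eulerMascheroniConstant + Real.log ((N : ℝ) - 1) +
    Real.log (ballProb volume (x i) (minDist (x i) (otherPoints x i))) + Real.log (f (x i))

lemma sampleError_comp_perm (f : E → ℝ) {N : ℕ} (x : Fin N → E) (σ : Equiv.Perm (Fin N))
    (i : Fin N) : sampleError f (x ∘ σ) i = sampleError f x (σ i) := by
  rw [sampleError, sampleError, Function.comp_apply, minDist_otherPoints_comp_perm]

lemma sampleError_zero (f : E → ℝ) {n : ℕ} (x : Fin (n + 3) → E) :
    sampleError f x 0 = pairError f (x 0) (x 1) fun j : Fin (n + 1) => x j.succ.succ := by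
  have hcard : ((n + 3 : ℕ) : ℝ) - 1 = (Fintype.card (Fin (n + 1)) : ℝ) + 1 := by
    rw [Fintype.card_fin]
    push_cast
    ring
  rw [sampleError, pairError, minDist_otherPoints_zero, hcard]

lemma sampleError_one (f : E → ℝ) {n : ℕ} (x : Fin (n + 3) → E) :
    sampleError f x 1 = pairError f (x 1) (x 0) fun j : Fin (n + 1) => x j.succ.succ := by
  have hfix (j : Fin (n + 1)) : Equiv.swap (0 : Fin (n + 3)) 1 j.succ.succ = j.succ.succ :=
    Equiv.swap_apply_of_ne_of_ne (Fin.succ_ne_zero _) fun hj =>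
      Fin.succ_ne_zero j (Fin.succ_injective _ hj)
  have hswap := sampleError_comp_perm f x (Equiv.swap 0 1) 0
  rw [sampleError_zero, Equiv.swap_apply_left] at hswap
  simpa [hfix] using hswap.symm

lemma measurable_minDist_otherPoints {N : ℕ} (i : Fin N) :
    Measurable fun x : Fin N → E => minDist (x i) (otherPoints x i) :=
  measurable_minDist.comp ((measurable_pi_apply i).prodMk
    (measurable_pi_lambda _ fun j => measurable_pi_apply j.1))

lemma measurable_sampleError {f : E → ℝ} (hf : Measurable fun x => Real.log (f x)) {N : ℕ}
    (i : Fin N) : Measurable fun x : Fin N → E => sampleError f x i := by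
  have hball := measurable_ballProb (μ := (volume : Measure E)) |>.comp
    ((measurable_pi_apply i).prodMk (measurable_minDist_otherPoints i)) |>.log
  exact (hball.const_add _).add (hf.comp (measurable_pi_apply i))

end Sampling

section Consistency

lemma tendsto_eulerMascheroni_add_log_sub_harmonic :
    Tendsto (fun n : ℕ => Real.eulerMascheroniConstant + Real.log ((n : ℝ) + 1) - harmonic n)
      atTop (𝓝 0) := by
  have hlim := Real.tendsto_eulerMascheroniSeq.const_sub Real.eulerMascheroniConstant
  rw [sub_self] at hlim
  refine hlim.congr fun n => ?_
  rw [Real.eulerMascheroniSeq]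
  ring

lemma HasLogQuadraticDensity.memLp_log {E : Type*} [NormedAddCommGroup E] [InnerProductSpace ℝ E]
    [FiniteDimensional ℝ E] [MeasurableSpace E] [BorelSpace E] {μ : Measure E}
    [IsProbabilityMeasure μ] {f : E → ℝ} (h : HasLogQuadraticDensity μ f) (hμ : MemLp id 4 μ) :
    MemLp (fun x => Real.log (f x)) 2 μ := by
  obtain ⟨K, hK⟩ := h.exists_abs_log_le
  exact (((memLp_const (1 : ℝ)).add (memLp_norm_sq_of_memLp_four hμ)).const_mul K).mono
    h.continuous_log.aestronglyMeasurable
    (Eventually.of_forall fun x => (hK x).trans (le_abs_self _))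

namespace IsIIDSequence

lemma hasLaw_comp_perm {Ω E : Type*} [MeasurableSpace Ω] [MeasurableSpace E] {P : Measure Ω}
    {μ : Measure E} [IsProbabilityMeasure μ] {X : ℕ → Ω → E} (hX : IsIIDSequence P μ X) {N : ℕ}
    (σ : Equiv.Perm (Fin N)) :
    HasLaw (fun ω => (fun i : Fin N => X i ω) ∘ σ) (Measure.pi fun _ => μ) P :=
  (measurePreserving_arrowCongr' (fun _ => μ) (fun _ => μ) σ.symm (MeasurableEquiv.refl E)
    fun _ => MeasurePreserving.id μ).hasLaw.comp (hX.hasLaw_fin N)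

variable {E : Type*} [NormedAddCommGroup E] [InnerProductSpace ℝ E] [FiniteDimensional ℝ E]
  [MeasurableSpace E] [BorelSpace E] {μ : Measure E} [IsProbabilityMeasure μ]
  {f : E → ℝ} {Ω : Type*} [MeasurableSpace Ω] {P : Measure Ω} {X : ℕ → Ω → E}

lemma integral_sampleError_mul (hX : IsIIDSequence P μ X) (h : HasLogQuadraticDensity μ f) {N : ℕ}
    (σ : Equiv.Perm (Fin N)) (a b : Fin N) :
    ∫ ω, sampleError f (fun i : Fin N => X i ω) (σ a) *
        sampleError f (fun i : Fin N => X i ω) (σ b) ∂P =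
      ∫ ω, sampleError f (fun i : Fin N => X i ω) a *
        sampleError f (fun i : Fin N => X i ω) b ∂P := by
  have hmeas := ((measurable_sampleError h.continuous_log.measurable a).mul
    (measurable_sampleError h.continuous_log.measurable b)).aestronglyMeasurable
    (μ := Measure.pi fun _ : Fin N => μ)
  simp only [← sampleError_comp_perm]
  exact ((hX.hasLaw_comp_perm σ).integral_comp hmeas).trans
    ((hX.hasLaw_fin N).integral_comp hmeas).symm

variable [Nontrivial E]

lemma ae_minDist_otherPoints_pos (hX : IsIIDSequence P μ X) (h : HasLogQuadraticDensity μ f)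
    {N : ℕ} (hN : 2 ≤ N) :
    ∀ᵐ ω ∂P, ∀ i : Fin N, 0 < minDist (X i ω) (otherPoints (fun i : Fin N => X i ω) i) := by
  refine ae_all_iff.2 fun i => ?_
  have := nonempty_ne hN i
  simp only [lt_minDist_iff]
  exact ae_all_iff.2 fun j => h.ae_dist_pos (hX.hasLaw_pair (Fin.val_ne_of_ne j.2.symm))

lemma memLp_log_minDist_otherPoints (hX : IsIIDSequence P μ X) (h : HasLogQuadraticDensity μ f)
    (hμ : MemLp id 4 μ) {N : ℕ} (hN : 2 ≤ N) (i : Fin N) :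
    MemLp (fun ω => Real.log (minDist (X i ω) (otherPoints (fun i : Fin N => X i ω) i))) 2 P := by
  have := hX.isProbabilityMeasure
  have := nonempty_ne hN i
  have hsum : MemLp (fun ω => ∑ j : {j : Fin N // j ≠ i}, ‖Real.log (dist (X i ω) (X j ω))‖) 2 P :=
    memLp_finsetSum _ fun j _ =>
      (h.memLp_log_dist hμ (hX.hasLaw_pair (Fin.val_ne_of_ne j.2.symm))).norm
  have hmeas := (measurable_minDist_otherPoints i).comp_aemeasurable (hX.hasLaw_fin N).aemeasurable
  exact hsum.mono hmeas.log.aestronglyMeasurable (Eventually.of_forall fun ω =>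
    (norm_log_minDist_le_sum _ _).trans (le_abs_self _))

lemma memLp_sampleError (hX : IsIIDSequence P μ X) (h : HasLogQuadraticDensity μ f)
    (hμ : MemLp id 4 μ) {N : ℕ} (hN : 2 ≤ N) (i : Fin N) :
    MemLp (fun ω => sampleError f (fun i : Fin N => X i ω) i) 2 P := by
  have := hX.isProbabilityMeasure
  have hlog := ((hX.memLp_log_minDist_otherPoints h hμ hN i).const_mul
    (Module.finrank ℝ E : ℝ)).add (memLp_const (Real.log (ballProb volume (0 : E) 1)))
  refine (((memLp_const (Real.eulerMascheroniConstant + Real.log ((N : ℝ) - 1))).add hlog).add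
    (memLp_comp_of_hasLaw (h.memLp_log hμ) (hX.hasLaw i))).ae_eq ?_
  filter_upwards [hX.ae_minDist_otherPoints_pos h hN] with ω hω
  rw [sampleError, log_ballProb_volume _ (hω i)]
  rfl

lemma memLp_mean_sampleError (hX : IsIIDSequence P μ X) (h : HasLogQuadraticDensity μ f)
    (hμ : MemLp id 4 μ) {N : ℕ} (hN : 2 ≤ N) :
    MemLp (fun ω => (1 : ℝ) / N * ∑ i, sampleError f (fun i : Fin N => X i ω) i) 2 P :=
  (memLp_finsetSum _ fun i _ => hX.memLp_sampleError h hμ hN i).const_mul _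

lemma exists_tendsto_integral_sampleError_sq_le (hX : IsIIDSequence P μ X)
    (h : HasLogQuadraticDensity μ f) (hμ : MemLp id 4 μ) :
    ∃ a : ℕ → ℝ, ∃ A, Tendsto a atTop (𝓝 A) ∧ ∀ n (i : Fin (n + 3)),
      ∫ ω, sampleError f (fun i : Fin (n + 3) => X i ω) i *
        sampleError f (fun i : Fin (n + 3) => X i ω) i ∂P ≤ a n := by
  have := hX.isProbabilityMeasure
  have hlim := (((hX.tendsto_integral_truncationGap_sq h hμ).const_mul 2).const_add
    (4 * Real.eulerMascheroniConstant ^ 2 + 144)).const_mul 2 |>.add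
    ((hX.tendsto_integral_truncationError_sq h hμ).const_mul 2)
  refine ⟨_, _, hlim, fun n i => ?_⟩
  have hperm := hX.integral_sampleError_mul h (Equiv.swap 0 i) 0 0
  rw [Equiv.swap_apply_left] at hperm
  rw [hperm]
  simp only [sampleError_zero, ← pow_two]
  exact h.integral_pairError_sq_le hμ (hX.hasLaw_tailPoints n)

lemma exists_tendsto_integral_sampleError_mul_le (hX : IsIIDSequence P μ X)
    (h : HasLogQuadraticDensity μ f) (hμ : MemLp id 4 μ) :
    ∃ b : ℕ → ℝ, Tendsto b atTop (𝓝 0) ∧ (∀ n, 0 ≤ b n) ∧ ∀ n (i j : Fin (n + 3)), i ≠ j →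
      ∫ ω, sampleError f (fun i : Fin (n + 3) => X i ω) i *
        sampleError f (fun i : Fin (n + 3) => X i ω) j ∂P ≤ b n := by
  have := hX.isProbabilityMeasure
  have hgap := hX.tendsto_integral_truncationGap_sq h hμ
  have herr := hX.tendsto_integral_truncationError_sq h hμ
  have hmean := (tendsto_add_atTop_iff_nat 1).2 tendsto_eulerMascheroni_add_log_sub_harmonic
  have hlim := (((hmean.pow 2).const_mul 2).add (hgap.const_mul 2)).add
    ((((hgap.const_mul 2).const_add (4 * Real.eulerMascheroniConstant ^ 2 + 144)).sqrt.mul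
      herr.sqrt).const_mul 2) |>.add herr
  simp only [zero_pow two_ne_zero, mul_zero, add_zero, Real.sqrt_zero] at hlim
  refine ⟨_, hlim, fun n => ?_, fun n i j hij => ?_⟩
  · positivity
  · obtain ⟨σ, rfl, rfl⟩ := exists_perm_apply (zero_ne_one : (0 : Fin (n + 3)) ≠ 1) hij
    rw [hX.integral_sampleError_mul h σ 0 1]
    simp only [sampleError_zero, sampleError_one]
    have hle := h.integral_pairError_mul_le hμ (hX.hasLaw_tailPoints n)
    rw [Fintype.card_fin] at hle
    exact hle

lemma tendsto_integral_mean_sampleError_sq (hX : IsIIDSequence P μ X)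
    (h : HasLogQuadraticDensity μ f) (hμ : MemLp id 4 μ) :
    Tendsto (fun N : ℕ => ∫ ω, ((1 : ℝ) / N *
      ∑ i, sampleError f (fun i : Fin N => X i ω) i) ^ 2 ∂P) atTop (𝓝 0) := by
  rw [← tendsto_add_atTop_iff_nat 3]
  obtain ⟨a, A, ha, hdiag⟩ := hX.exists_tendsto_integral_sampleError_sq_le h hμ
  obtain ⟨b, hb, hb0, hoff⟩ := hX.exists_tendsto_integral_sampleError_mul_le h hμ
  have hN : Tendsto (fun n : ℕ => ((n + 3 : ℕ) : ℝ)) atTop atTop :=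
    tendsto_natCast_atTop_atTop.comp (tendsto_add_atTop_nat 3)
  have hlim : Tendsto (fun n => a n / ((n + 3 : ℕ) : ℝ) + b n) atTop (𝓝 0) := by
    simpa using (ha.div_atTop hN).add hb
  refine squeeze_zero (fun n => integral_nonneg fun ω => sq_nonneg _) (fun n => ?_) hlim
  exact integral_mean_sq_le (by omega) (fun i => hX.memLp_sampleError h hμ (by omega) i)
    (hdiag n) (hoff n) (hb0 n)

end IsIIDSequence

end Consistency

section KozachenkoLeonenko

variable {d : ℕ} {μ : Measure (EuclideanSpace ℝ (Fin d))}
  {f : EuclideanSpace ℝ (Fin d) → ℝ} {Ω : Type*} [MeasurableSpace Ω] {P : Measure Ω}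
  {X : ℕ → Ω → EuclideanSpace ℝ (Fin d)}

namespace HasLogQuadraticDensity

lemma lebesgueDensity_ae_eq (h : HasLogQuadraticDensity μ f) :
    lebesgueDensity μ =ᵐ[volume] f := by
  rw [h.eq_withDensity]
  filter_upwards [Measure.rnDeriv_withDensity volume h.continuous.measurable.ennreal_ofReal]
    with x hx
  rw [lebesgueDensity, hx, ENNReal.toReal_ofReal (h.pos x).le]

lemma lebesgueDensity_mul_log_ae_eq (h : HasLogQuadraticDensity μ f) :
    (fun x => lebesgueDensity μ x * Real.log (lebesgueDensity μ x)) =ᵐ[volume]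
      fun x => (ENNReal.ofReal (f x)).toReal • Real.log (f x) := by
  filter_upwards [h.lebesgueDensity_ae_eq] with x hx
  rw [hx, ENNReal.toReal_ofReal (h.pos x).le, smul_eq_mul]

lemma integrable_lebesgueDensity_mul_log [IsProbabilityMeasure μ] (h : HasLogQuadraticDensity μ f)
    (hμ : MemLp id 4 μ) :
    Integrable fun x => lebesgueDensity μ x * Real.log (lebesgueDensity μ x) := by
  rw [integrable_congr h.lebesgueDensity_mul_log_ae_eq,
    ← integrable_withDensity_iff_integrable_smul' h.continuous.measurable.ennreal_ofReal
      (Eventually.of_forall fun x => ENNReal.ofReal_lt_top), ← h.eq_withDensity]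
  exact (h.memLp_log hμ).integrable one_le_two

lemma shannonEntropy_lebesgueDensity (h : HasLogQuadraticDensity μ f) :
    shannonEntropy (lebesgueDensity μ) = -∫ x, Real.log (f x) ∂μ := by
  rw [shannonEntropy, integral_congr_ae h.lebesgueDensity_mul_log_ae_eq,
    ← integral_withDensity_eq_integral_toReal_smul h.continuous.measurable.ennreal_ofReal
      (Eventually.of_forall fun x => ENNReal.ofReal_lt_top), ← h.eq_withDensity]

end HasLogQuadraticDensity

lemma kozachenkoLeonenko_eq_mean_log_minDist {N : ℕ} (x : Fin N → EuclideanSpace ℝ (Fin d))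
    (hx : ∀ i, 0 < minDist (x i) (otherPoints x i)) :
    kozachenkoLeonenko x = d * ((1 : ℝ) / N * ∑ i, Real.log (minDist (x i) (otherPoints x i))) +
      Real.log (unitBallVolume d) + Real.eulerMascheroniConstant + Real.log ((N : ℝ) - 1) := by
  have hlog : Real.log (∏ i, nearestNeighborDist x i) =
      ∑ i, Real.log (minDist (x i) (otherPoints x i)) :=
    Real.log_prod fun i _ => (hx i).ne'
  have hprod : 0 < ∏ i, nearestNeighborDist x i := Finset.prod_pos fun i _ => hx i
  rw [kozachenkoLeonenko, meanNearestNeighborDist, Real.log_rpow hprod, hlog]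

variable [Nontrivial (EuclideanSpace ℝ (Fin d))]

lemma ballProb_volume_zero_one :
    ballProb volume (0 : EuclideanSpace ℝ (Fin d)) 1 = unitBallVolume d := by
  rw [ballProb, measureReal_def, InnerProductSpace.volume_closedBall, unitBallVolume]
  simp only [ENNReal.ofReal_one, one_pow, one_mul, finrank_euclideanSpace_fin]
  rw [ENNReal.toReal_ofReal (by positivity), Real.sqrt_eq_rpow, ← Real.rpow_natCast,
    ← Real.rpow_mul Real.pi_pos.le, one_div_mul_eq_div]

lemma kozachenkoLeonenko_eq_mean_sampleError_sub (f : EuclideanSpace ℝ (Fin d) → ℝ) {N : ℕ}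
    (hN : N ≠ 0) (x : Fin N → EuclideanSpace ℝ (Fin d))
    (hx : ∀ i, 0 < minDist (x i) (otherPoints x i)) :
    kozachenkoLeonenko x = (1 : ℝ) / N * ∑ i, sampleError f x i -
      (1 : ℝ) / N * ∑ i, Real.log (f (x i)) := by
  have hterm (i : Fin N) : sampleError f x i - Real.log (f (x i)) =
      d * Real.log (minDist (x i) (otherPoints x i)) +
        (Real.log (unitBallVolume d) + Real.eulerMascheroniConstant + Real.log ((N : ℝ) - 1)) := by
    rw [sampleError, log_ballProb_volume _ (hx i), finrank_euclideanSpace_fin,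
      ballProb_volume_zero_one]
    ring
  rw [kozachenkoLeonenko_eq_mean_log_minDist x hx, ← mul_sub, ← Finset.sum_sub_distrib]
  simp only [hterm, Finset.sum_add_distrib, ← Finset.mul_sum, Finset.sum_const, Finset.card_univ,
    Fintype.card_fin, nsmul_eq_mul]
  field_simp
  ring

namespace IsIIDSequence

variable [IsProbabilityMeasure μ]

lemma kozachenkoLeonenko_ae_eq (hX : IsIIDSequence P μ X) (h : HasLogQuadraticDensity μ f) {N : ℕ}
    (hN : 2 ≤ N) :
    (fun ω => kozachenkoLeonenko fun i : Fin N => X i ω) =ᵐ[P] fun ω =>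
      (1 : ℝ) / N * ∑ i, sampleError f (fun i : Fin N => X i ω) i -
        (1 : ℝ) / N * ∑ i : Fin N, Real.log (f (X i ω)) := by
  filter_upwards [hX.ae_minDist_otherPoints_pos h hN] with ω hω
  exact kozachenkoLeonenko_eq_mean_sampleError_sub f (by omega) _ hω

lemma memLp_kozachenkoLeonenko (hX : IsIIDSequence P μ X) (h : HasLogQuadraticDensity μ f)
    (hμ : MemLp id 4 μ) {N : ℕ} (hN : 2 ≤ N) :
    MemLp (fun ω => kozachenkoLeonenko fun i : Fin N => X i ω) 2 P :=
  ((hX.memLp_mean_sampleError h hμ hN).sub (hX.memLp_mean_comp (h.memLp_log hμ) N)).ae_eq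
    (hX.kozachenkoLeonenko_ae_eq h hN).symm

lemma tendsto_integral_kozachenkoLeonenko_sub_sq (hX : IsIIDSequence P μ X)
    (h : HasLogQuadraticDensity μ f) (hμ : MemLp id 4 μ) :
    Tendsto (fun N : ℕ => ∫ ω, (kozachenkoLeonenko (fun i : Fin N => X i ω) -
      shannonEntropy (lebesgueDensity μ)) ^ 2 ∂P) atTop (𝓝 0) := by
  have := hX.isProbabilityMeasure
  have hlim := ((hX.tendsto_integral_mean_sampleError_sq h hμ).const_mul 2).add
    ((hX.tendsto_integral_mean_comp_sub_sq (h.memLp_log hμ)).const_mul 2)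
  simp only [mul_zero, add_zero] at hlim
  refine squeeze_zero' (Eventually.of_forall fun N => integral_nonneg fun ω => sq_nonneg _) ?_ hlim
  filter_upwards [eventually_ge_atTop 2] with N hN
  have hlog := (hX.memLp_mean_comp (h.memLp_log hμ) N).sub (memLp_const (∫ x, Real.log (f x) ∂μ))
  have hle := integral_add_sq_le (hX.memLp_mean_sampleError h hμ hN) hlog.neg
  simp only [Pi.neg_apply, Pi.sub_apply, neg_sq] at hle
  refine (integral_congr_ae ?_).trans_le hle
  filter_upwards [hX.kozachenkoLeonenko_ae_eq h hN] with ω hω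
  rw [hω, h.shannonEntropy_lebesgueDensity]
  ring

end IsIIDSequence

end KozachenkoLeonenko

lemma hasLogQuadraticDensity_gaussianDensity {d : ℕ} {ν : EuclideanSpace ℝ (Fin d)}
    {S : Matrix (Fin d) (Fin d) ℝ} (hS : S.PosDef) :
    HasLogQuadraticDensity (multivariateGaussian ν S) (gaussianDensity ν S) :=
  ⟨multivariateGaussian_eq_withDensity hS, continuous_gaussianDensity, gaussianDensity_pos hS,
    exists_abs_log_gaussianDensity_le hS⟩

theorem corollary4_general {d : ℕ} (hd : 1 ≤ d) {μ : Measure (EuclideanSpace ℝ (Fin d))}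
    [IsProbabilityMeasure μ] {f : EuclideanSpace ℝ (Fin d) → ℝ} (hf : HasLogQuadraticDensity μ f)
    (hμ : MemLp id 4 μ) {Ω : Type*} [MeasurableSpace Ω] {P : Measure Ω}
    {X : ℕ → Ω → EuclideanSpace ℝ (Fin d)} (hX : IsIIDSequence P μ X) :
    (μ ≪ volume ∧ Integrable fun x => lebesgueDensity μ x * Real.log (lebesgueDensity μ x)) ∧
    (∀ N : ℕ, 2 ≤ N → MemLp (fun ω => kozachenkoLeonenko (fun i : Fin N => X i ω)) 2 P) ∧
    Tendsto (fun N : ℕ => ∫ ω, kozachenkoLeonenko (fun i : Fin N => X i ω) ∂P)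
      atTop (𝓝 (shannonEntropy (lebesgueDensity μ))) ∧
    Tendsto (fun N : ℕ => ∫ ω, (kozachenkoLeonenko (fun i : Fin N => X i ω) -
      shannonEntropy (lebesgueDensity μ)) ^ 2 ∂P) atTop (𝓝 0) := by
  have : Nontrivial (EuclideanSpace ℝ (Fin d)) :=
    Module.nontrivial_of_finrank_pos (R := ℝ) (by rwa [finrank_euclideanSpace_fin])
  have := hX.isProbabilityMeasure
  have hL2 := hX.tendsto_integral_kozachenkoLeonenko_sub_sq hf hμ
  have hmem (N : ℕ) (hN : 2 ≤ N) := hX.memLp_kozachenkoLeonenko hf hμ hN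
  exact ⟨⟨hf.absolutelyContinuous, hf.integrable_lebesgueDensity_mul_log hμ⟩, hmem,
    tendsto_integral_of_tendsto_integral_sub_sq ((eventually_ge_atTop 2).mono hmem) hL2, hL2⟩

theorem corollary4 {d : ℕ} (hd : 1 ≤ d)
    (ν : EuclideanSpace ℝ (Fin d)) (S : Matrix (Fin d) (Fin d) ℝ) (hS : S.PosDef)
    {Ω : Type*} [MeasurableSpace Ω] (P : Measure Ω) [IsProbabilityMeasure P]
    (X : ℕ → Ω → EuclideanSpace ℝ (Fin d))
    (hlaw : ∀ i, HasLaw (X i) (multivariateGaussian ν S) P)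
    (hindep : iIndepFun X P)
    (H : ℝ) (hH : H = 1 / 2 * Real.log (((2 * Real.pi * Real.exp 1) • S).det)) :
    -- the Gaussian law has a density `f`, and `H` is the entropy `-∫ f log f`
    (multivariateGaussian ν S ≪ (volume : Measure (EuclideanSpace ℝ (Fin d))) ∧
      Integrable (fun x => lebesgueDensity (multivariateGaussian ν S) x *
        Real.log (lebesgueDensity (multivariateGaussian ν S) x)) ∧
      shannonEntropy (lebesgueDensity (multivariateGaussian ν S)) = H) ∧
    -- the estimates are square integrable
    (∀ N : ℕ, 2 ≤ N →
      MemLp (fun ω => kozachenkoLeonenko (fun i : Fin N => X i ω)) 2 P) ∧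
    -- asymptotic unbiasedness
    Tendsto (fun N : ℕ => ∫ ω, kozachenkoLeonenko (fun i : Fin N => X i ω) ∂P)
      atTop (𝓝 H) ∧
    -- consistency in mean square
    Tendsto (fun N : ℕ => ∫ ω, (kozachenkoLeonenko (fun i : Fin N => X i ω) - H) ^ 2 ∂P)
      atTop (𝓝 0) := by
  have hf := hasLogQuadraticDensity_gaussianDensity (ν := ν) hS
  have hentropy : shannonEntropy (lebesgueDensity (multivariateGaussian ν S)) = H := by
    rw [hf.shannonEntropy_lebesgueDensity, integral_log_gaussianDensity hS, neg_neg, hH]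
  obtain ⟨⟨hac, hint⟩, hrest⟩ :=
    corollary4_general hd hf (IsGaussian.memLp_id _ 4 (by norm_num)) ⟨hlaw, hindep⟩
  exact ⟨⟨hac, hint, hentropy⟩, hentropy ▸ hrest⟩
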